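/- For a positive integer $r$, let $$F_r(z)=\sum_{n=0}^\infty\Big(\sum_{k=0}^n\binom{n}{k}^r\Big)z^n,\qquad G_r(z)=\sum_{n=0}^\infty\Big(\sum_{k=0}^n\binom{n}{k}^r\binom{n+k}{k}^r\Big)z^n,\qquad H_r(z)=\sum_{n=0}^\infty\Big(\sum_{k=0}^n\binom{n}{k}^{2r}\binom{n+k}{k}^r\Big)z^n .$$ Then the family consisting of all $F_r$ with $r\ge 3$, all $G_r$ with $r\ge 2$ and all $H_r$ with $r\ge 1$ is algebraically independent over $\mathbb{C}(z)$ (as elements of the field $\mathbb{C}((z))$ of formal Laurent series): the listed series are pairwise distinct, and no finitely many of them satisfy a non-trivial polynomial relation with coefficients in $\mathbb{C}(z)$. -/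

import Mathlib

open scoped LaurentSeries RatFunc

/-- The generating series `∑ₙ (∑ₖ C(n,k)^r) zⁿ`. -/
noncomputable def franelSeries (r : ℕ) : PowerSeries ℂ :=
  PowerSeries.mk fun n => ((∑ k ∈ Finset.range (n + 1), n.choose k ^ r : ℕ) : ℂ)

/-- The generating series `∑ₙ (∑ₖ C(n,k)^r C(n+k,k)^r) zⁿ`. -/
noncomputable def delannoySeries (r : ℕ) : PowerSeries ℂ :=
  PowerSeries.mk fun n =>
    ((∑ k ∈ Finset.range (n + 1), n.choose k ^ r * (n + k).choose k ^ r : ℕ) : ℂ)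

/-- The generating series `∑ₙ (∑ₖ C(n,k)^(2r) C(n+k,k)^r) zⁿ`. -/
noncomputable def aperySeries (r : ℕ) : PowerSeries ℂ :=
  PowerSeries.mk fun n =>
    ((∑ k ∈ Finset.range (n + 1), n.choose k ^ (2 * r) * (n + k).choose k ^ r : ℕ) : ℂ)

/-- The three families together, indexed by the disjoint union of the admissible parameters. -/
noncomputable def binomialSumSeries :
    ({r : ℕ // 3 ≤ r} ⊕ {r : ℕ // 2 ≤ r} ⊕ {r : ℕ // 1 ≤ r}) → PowerSeries ℂ
  | .inl r => franelSeries r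
  | .inr (.inl r) => delannoySeries r
  | .inr (.inr r) => aperySeries r

/-! The proof has an arithmetic half and an analytic half, meeting at a relation between just two
monomials.

Arithmetic. The coefficients satisfy Lucas congruences b(np+m) ≡ b(n)b(m) mod p for m < p
(`cast_binomSum_lucas`). So modulo p each series satisfies f = A f^p, with A its truncation of
degree below p, and for every monomial g in the series Frobenius is multiplication by a rational
function. Comparing a relation with its p-th power and eliminating a term shows that linearly
dependent monomials include two that are proportional over F_p(z)
(`exists_proportional_of_relation`). The (p-1)-th power of the proportionality factor is a quotient
of products of truncations, which bounds its degree independently of p. An algebraic relation over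
ℂ(z) descends to every p, the pigeonhole principle selects one pair of monomials that works for
infinitely many p, and bounded degree lets the relation between them return to ℚ
(`exists_proportional_monomials_of_lucas`).

Analytic. The inverse radii of convergence are powers of 2, 3+2√2 and (11+5√5)/2, and are pairwise
distinct. After cancelling common factors, look at the smallest radius in the two-monomial relation:
only one series F is singular there, so some power of F would be meromorphic at that point.
Coefficients of size O(λ^n/n) allow F only logarithmic growth, so there is no pole; hence F itself
would extend analytically, which a polynomial lower bound on b(n)/λ^n forbids
(`GrowthBounds.not_meromorphic`). The O(λ^n/n) bound is what fails for the excluded small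
parameters. For the second and third families it comes from Apéry's recurrences at the least
admissible r, and passes to larger r by `growthBounds_sum_pow`. -/

/-! ### Linear relations between integer sequences in characteristics 0 and p. -/

/-- A linear relation over `ℂ` between integer sequences yields one over `ZMod p`. -/
theorem exists_zmod_relation {κ : Type*} [Fintype κ] (v : κ → ℕ → ℤ) (c : κ → ℂ) (hc : c ≠ 0)
    (h : ∀ n, ∑ k, c k * v k n = 0) (p : ℕ) (hp : p.Prime) :
    ∃ d : κ → ZMod p, d ≠ 0 ∧ ∀ n, ∑ k, d k * (v k n : ZMod p) = 0 := by
  classical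
  obtain ⟨k₀, hk₀⟩ := Function.ne_iff.1 hc
  -- A ℚ-linear functional ℂ → ℚ not vanishing at `c k₀` carries the relation to ℚ.
  obtain ⟨l, hl⟩ := Module.Projective.exists_dual_ne_zero ℚ hk₀
  have hq : ∀ n, ∑ k, l (c k) * v k n = 0 := by
    intro n
    have h1 := congrArg l (h n)
    rw [map_sum, map_zero] at h1
    rw [← h1]
    refine Finset.sum_congr rfl fun k _ => ?_
    rw [mul_comm (c k), ← zsmul_eq_mul, map_zsmul, zsmul_eq_mul, mul_comm]
  obtain ⟨b, hb⟩ := IsLocalization.exist_integer_multiples_of_finset (nonZeroDivisors ℤ)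
    (Finset.univ.image fun k => l (c k))
  have hb' : ∀ k, ∃ z : ℤ, (z : ℚ) = (b : ℤ) * l (c k) := by
    intro k
    obtain ⟨z, hz⟩ := hb (l (c k)) (Finset.mem_image_of_mem _ (Finset.mem_univ k))
    exact ⟨z, by simpa using hz⟩
  choose z hz using hb'
  have hb0 : (b : ℤ) ≠ 0 := nonZeroDivisors.coe_ne_zero b
  -- Dividing by the gcd makes the coefficients coprime, so that they do not all vanish mod `p`.
  obtain ⟨g, hg, hg1⟩ := Finset.univ.extract_gcd z ⟨k₀, Finset.mem_univ _⟩
  have hgcd : Finset.univ.gcd z ≠ 0 := by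
    intro h0
    have h1 := hz k₀
    rw [Finset.gcd_eq_zero_iff.1 h0 k₀ (Finset.mem_univ _), Int.cast_zero, eq_comm,
      mul_eq_zero] at h1
    exact h1.elim (by exact_mod_cast hb0) hl
  have hzrel : ∀ n, ∑ k, g k * v k n = 0 := by
    intro n
    have h1 : ((∑ k, z k * v k n : ℤ) : ℚ) = (b : ℤ) * ∑ k, l (c k) * v k n := by
      push_cast
      rw [Finset.mul_sum]
      exact Finset.sum_congr rfl fun k _ => by rw [hz]; ring
    rw [hq, mul_zero, Int.cast_eq_zero] at h1
    have h2 : Finset.univ.gcd z * ∑ k, g k * v k n = 0 := by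
      rw [← h1, Finset.mul_sum]
      exact Finset.sum_congr rfl fun k hk => by rw [hg k hk]; ring
    exact (mul_eq_zero.1 h2).resolve_left hgcd
  refine ⟨fun k => (g k : ZMod p), fun h0 => ?_, fun n => ?_⟩
  · have h1 : (p : ℤ) ∣ Finset.univ.gcd g := Finset.dvd_gcd fun k _ =>
      (ZMod.intCast_zmod_eq_zero_iff_dvd _ _).1 (congrFun h0 k)
    rw [hg1] at h1
    exact (Nat.prime_iff_prime_int.1 hp).not_isUnit (isUnit_of_dvd_one h1)
  · have h1 := congrArg (Int.cast (R := ZMod p)) (hzrel n)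
    push_cast at h1
    exact h1

theorem span_eq_top_of_no_relation {κ : Type*} [Fintype κ] (v : κ → ℕ → ℤ)
    (h : ∀ c : κ → ℚ, (∀ n, ∑ k, c k * v k n = 0) → c = 0) :
    Submodule.span ℚ (Set.range fun n => fun k => (v k n : ℚ)) = ⊤ := by
  classical
  by_contra hne
  obtain ⟨f, hf, hle⟩ := Submodule.exists_le_ker_of_lt_top _ (lt_top_iff_ne_top.2 hne)
  have hfe : ∀ x : κ → ℚ, f x = ∑ k, f (Pi.single k 1) * x k := by
    intro x
    conv_lhs => rw [pi_eq_sum_univ' x, map_sum]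
    refine Finset.sum_congr rfl fun k _ => ?_
    rw [map_smul, smul_eq_mul, mul_comm]
  have h0 : (fun k => f (Pi.single k 1)) = 0 := by
    apply h
    intro n
    rw [← hfe (fun k => (v k n : ℚ))]
    exact hle (Submodule.subset_span ⟨n, rfl⟩)
  apply hf
  ext k
  simp [congrFun h0 k]

/-- Integer sequences that are linearly dependent modulo infinitely many primes are linearly
dependent over `ℚ`. -/
theorem exists_rat_relation {κ : Type*} [Fintype κ] (v : κ → ℕ → ℤ)
    (hS : {p : ℕ | p.Prime ∧ ∃ d : κ → ZMod p, d ≠ 0 ∧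
      ∀ n, ∑ k, d k * (v k n : ZMod p) = 0}.Infinite) :
    ∃ c : κ → ℚ, c ≠ 0 ∧ ∀ n, ∑ k, c k * v k n = 0 := by
  classical
  by_contra! hcon
  have htop := span_eq_top_of_no_relation v fun c hc => by
    by_contra hne
    obtain ⟨n, hn⟩ := hcon c hne
    exact hn (hc n)
  -- Without a rational relation the vectors of `n`-th terms span `ℚ^κ`, so a multiple `D k` of each
  -- basis vector is an integral combination of them. A prime exceeding all the `D k` then admits no
  -- relation.
  have key : ∀ k : κ, ∃ (D : ℕ) (_ : D ≠ 0) (a : ℕ →₀ ℤ), ∀ j,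
      a.sum (fun n x => x * v j n) = if j = k then (D : ℤ) else 0 := by
    intro k
    have hk : (Pi.single k 1 : κ → ℚ) ∈
        Submodule.span ℚ (Set.range fun n => fun k => (v k n : ℚ)) := by
      rw [htop]; trivial
    obtain ⟨a, ha⟩ := Finsupp.mem_span_range_iff_exists_finsupp.1 hk
    obtain ⟨b, hb⟩ := IsLocalization.exist_integer_multiples_of_finset (nonZeroDivisors ℤ)
      (a.support.image a)
    have hb' : ∀ n, ∃ z : ℤ, (z : ℚ) = (b : ℤ) * a n := by
      intro n
      by_cases hn : n ∈ a.support
      · obtain ⟨z, hz⟩ := hb (a n) (Finset.mem_image_of_mem _ hn)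
        exact ⟨z, by simpa using hz⟩
      · exact ⟨0, by simp [Finsupp.notMem_support_iff.1 hn]⟩
    choose z hz using hb'
    have hb0 : (b : ℤ) ≠ 0 := nonZeroDivisors.coe_ne_zero b
    -- The square of the denominator is used because `b` may be negative.
    refine ⟨((b : ℤ) ^ 2).natAbs, by simp [hb0],
      Finsupp.onFinset a.support (fun n => b * z n) ?_, ?_⟩
    · intro n hn
      rw [Finsupp.mem_support_iff]
      intro h0
      apply hn
      have := hz n
      rw [h0, mul_zero] at this
      simp [Int.cast_eq_zero.1 this]
    · intro j
      have h1 := congrFun ha j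
      rw [Finsupp.onFinset_sum _ (by simp)]
      have h2 : ((∑ n ∈ a.support, (b : ℤ) * z n * v j n : ℤ) : ℚ) =
          (b : ℤ) ^ 2 * (Pi.single k 1 : κ → ℚ) j := by
        rw [← h1, Finsupp.sum, Finset.sum_apply, Finset.mul_sum]
        push_cast
        refine Finset.sum_congr rfl fun n _ => ?_
        rw [hz n]; simp; ring
      rw [← Int.cast_inj (α := ℚ), h2]
      rw [Pi.single_apply]
      split_ifs <;> simp
  choose D hD a ha using key
  obtain ⟨p, ⟨hp, d, hd, hrel⟩, hlt⟩ := hS.exists_gt (∏ k, D k)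
  have := Fact.mk hp
  apply hd
  ext k
  have hDk : (D k : ZMod p) ≠ 0 := by
    rw [Ne, ZMod.natCast_eq_zero_iff]
    intro hdvd
    have h1 := Nat.le_of_dvd (Finset.prod_pos fun k _ => Nat.pos_of_ne_zero (hD k))
      (hdvd.trans (Finset.dvd_prod_of_mem D (Finset.mem_univ k)))
    omega
  have h1 : ∑ j, d j * (((a k).sum (fun n x => x * v j n) : ℤ) : ZMod p) = 0 := by
    simp only [Finsupp.sum, Int.cast_sum, Int.cast_mul, Finset.mul_sum]
    rw [Finset.sum_comm]
    refine Finset.sum_eq_zero fun n _ => ?_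
    calc _ = ((a k n : ℤ) : ZMod p) * ∑ j, d j * (v j n : ZMod p) := by
          rw [Finset.mul_sum]; exact Finset.sum_congr rfl fun j _ => by ring
      _ = 0 := by rw [hrel, mul_zero]
  simp only [ha, Int.cast_ite, Int.cast_zero, mul_ite, mul_zero, Finset.sum_ite_eq',
    Finset.mem_univ, if_true, Int.cast_natCast] at h1
  simpa [hDk] using h1

/-! ### Lucas congruences for binomial sums. -/

/-- The sums `∑ₖ C(n,k)^r C(n+k,k)^s`. -/
def binomSum (r s n : ℕ) : ℕ :=
  ∑ k ∈ Finset.range (n + 1), n.choose k ^ r * (n + k).choose k ^ s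

theorem binomSum_zero (r s : ℕ) : binomSum r s 0 = 1 := by simp [binomSum]

theorem binomSum_eq_sum_range {r : ℕ} (hr : r ≠ 0) (s : ℕ) {n N : ℕ} (h : n + 1 ≤ N) :
    binomSum r s n = ∑ k ∈ Finset.range N, n.choose k ^ r * (n + k).choose k ^ s := by
  refine Finset.sum_subset (Finset.range_mono h) fun k _ hk => ?_
  rw [Nat.choose_eq_zero_of_lt (by simpa using hk), zero_pow hr, zero_mul]

theorem sum_range_mul_eq {M : Type*} [AddCommMonoid M] (f : ℕ → M) (a b : ℕ) :
    ∑ k ∈ Finset.range (a * b), f k =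
      ∑ i ∈ Finset.range a, ∑ j ∈ Finset.range b, f (i * b + j) := by
  induction a with
  | zero => simp
  | succ a ih => rw [Nat.succ_mul, Finset.sum_range_add, ih, Finset.sum_range_succ]

theorem cast_choose_lucas {p : ℕ} (hp : p.Prime) (n i : ℕ) {m j : ℕ} (hm : m < p) (hj : j < p) :
    ((n * p + m).choose (i * p + j) : ZMod p) = n.choose i * m.choose j := by
  have := Fact.mk hp
  have h := Choose.choose_modEq_choose_mod_mul_choose_div_nat (n := n * p + m) (k := i * p + j)
    (p := p)
  have e1 : ∀ x y, y < p → (x * p + y) % p = y := fun x y hy => by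
    rw [Nat.mul_comm, Nat.mul_add_mod, Nat.mod_eq_of_lt hy]
  have e2 : ∀ x y, y < p → (x * p + y) / p = x := fun x y hy => by
    rw [Nat.mul_comm, Nat.mul_add_div hp.pos, Nat.div_eq_of_lt hy, add_zero]
  rw [e1 _ _ hm, e1 _ _ hj, e2 _ _ hm, e2 _ _ hj] at h
  rw [(ZMod.natCast_eq_natCast_iff _ _ _).2 h]
  push_cast; ring

theorem cast_choose_add_lucas {p : ℕ} (hp : p.Prime) (n i : ℕ) {m j : ℕ} (hm : m < p) (hj : j < p) :
    ((n * p + m + (i * p + j)).choose (i * p + j) : ZMod p) =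
      (n + i).choose i * (m + j).choose j := by
  rcases lt_or_ge (m + j) p with h | h
  · rw [show n * p + m + (i * p + j) = (n + i) * p + (m + j) by ring,
      cast_choose_lucas hp _ _ h hj]
  -- If adding `m` and `j` produces a carry, the last digit `e = m + j - p` is smaller than `j`, and
  -- both sides vanish mod `p`.
  · obtain ⟨e, he⟩ := Nat.exists_eq_add_of_le h
    have h1 := cast_choose_lucas hp (n + i + 1) i (m := e) (j := j) (by omega) hj
    have h2 := cast_choose_lucas hp 1 0 (m := e) (j := j) (by omega) hj
    rw [show n * p + m + (i * p + j) = (n + i) * p + (m + j) by ring, he,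
      show (n + i) * p + (p + e) = (n + i + 1) * p + e by ring, h1]
    rw [one_mul, zero_mul, zero_add] at h2
    rw [h2, Nat.choose_eq_zero_of_lt (show e < j by omega)]
    simp

/-- Writing the summation index as `i * p + j` makes each summand a product of a term in `i` and a
term in `j`. The range can be enlarged to a multiple of `p` because `r ≠ 0` makes the extra terms
vanish. -/
theorem cast_binomSum_lucas {p : ℕ} (hp : p.Prime) {r : ℕ} (hr : r ≠ 0) (s n : ℕ) {m : ℕ} (hm : m < p) :
    (binomSum r s (n * p + m) : ZMod p) = binomSum r s n * binomSum r s m := by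
  rw [binomSum_eq_sum_range hr s (show n * p + m + 1 ≤ (n + 1) * p by nlinarith),
    binomSum_eq_sum_range hr s (show m + 1 ≤ p from hm), sum_range_mul_eq, binomSum]
  push_cast
  rw [Finset.sum_mul_sum]
  refine Finset.sum_congr rfl fun i _ => Finset.sum_congr rfl fun j hj => ?_
  have hj := Finset.mem_range.1 hj
  rw [cast_choose_lucas hp n i hm hj, cast_choose_add_lucas hp n i hm hj]
  ring

/-! ### The Frobenius argument modulo p. -/

/-- If the `p`-th power of each `g k` is a `K`-multiple of `g k`, then a linear relation over `K`
between the `g k` forces two of them to be proportional over `K`. -/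
theorem exists_proportional_of_relation {K L κ : Type*} [Field K] [Field L] [Algebra K L]
    (p : ℕ) [Fact p.Prime] [CharP L p] (g : κ → L) (u : κ → K) (hg : ∀ k, g k ≠ 0)
    (hu : ∀ k, g k ^ p = algebraMap K L (u k) * g k) (T : Finset κ) :
    ∀ c : κ → K, (∃ k ∈ T, c k ≠ 0) → ∑ k ∈ T, algebraMap K L (c k) * g k = 0 →
      ∃ k ∈ T, ∃ l ∈ T, k ≠ l ∧ ∃ e : K, g k = algebraMap K L e * g l := by
  classical
  induction T using Finset.strongInduction with
  | H T ih =>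
  rintro c ⟨k₀, hk₀, hc₀⟩ hrel
  have hp : p.Prime := Fact.out
  have hinj := (algebraMap K L).injective
  by_cases hz : ∃ k ∈ T, c k = 0
  · obtain ⟨k, hk, hck⟩ := hz
    have hne : k₀ ≠ k := fun h => hc₀ (h ▸ hck)
    obtain ⟨a, ha, b, hb, h⟩ := ih (T.erase k) (Finset.erase_ssubset hk) c
      ⟨k₀, Finset.mem_erase.2 ⟨hne, hk₀⟩, hc₀⟩ (by
        rw [← Finset.add_sum_erase _ _ hk, hck, map_zero, zero_mul, zero_add] at hrel
        exact hrel)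
    exact ⟨a, Finset.mem_of_mem_erase ha, b, Finset.mem_of_mem_erase hb, h⟩
  push Not at hz
  have hrelp : ∑ k ∈ T, algebraMap K L (c k ^ p * u k) * g k = 0 := by
    have h1 : (∑ k ∈ T, algebraMap K L (c k) * g k) ^ p = 0 := by rw [hrel, zero_pow hp.ne_zero]
    rw [sum_pow_char] at h1
    rw [← h1]
    refine Finset.sum_congr rfl fun k _ => ?_
    rw [mul_pow, hu, map_mul, map_pow, mul_assoc]
  -- The relation and its `p`-th power are combined so that the term at `k₀` cancels. Either a
  -- shorter nontrivial relation remains, or the two relations are proportional.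
  set d : κ → K := fun k => c k ^ p * u k * c k₀ - c k₀ ^ p * u k₀ * c k with hd
  have hdrel : ∑ k ∈ T, algebraMap K L (d k) * g k = 0 := by
    have h1 : ∑ k ∈ T, algebraMap K L (d k) * g k =
        algebraMap K L (c k₀) * (∑ k ∈ T, algebraMap K L (c k ^ p * u k) * g k) -
        algebraMap K L (c k₀ ^ p * u k₀) * ∑ k ∈ T, algebraMap K L (c k) * g k := by
      rw [Finset.mul_sum, Finset.mul_sum, ← Finset.sum_sub_distrib]
      refine Finset.sum_congr rfl fun k _ => ?_
      simp only [hd, map_sub, map_mul]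
      ring
    rw [h1, hrelp, hrel]; simp
  rw [← Finset.add_sum_erase _ _ hk₀, show d k₀ = 0 by simp only [hd]; ring, map_zero, zero_mul,
    zero_add] at hdrel
  by_cases hdz : ∃ k ∈ T.erase k₀, d k ≠ 0
  · obtain ⟨a, ha, b, hb, h⟩ := ih (T.erase k₀) (Finset.erase_ssubset hk₀) d hdz hdrel
    exact ⟨a, Finset.mem_of_mem_erase ha, b, Finset.mem_of_mem_erase hb, h⟩
  push Not at hdz
  have hex : ∃ k₁ ∈ T, k₁ ≠ k₀ := by
    by_contra! hall
    rw [Finset.sum_eq_single_of_mem k₀ hk₀ fun k hk hne => absurd (hall k hk) hne] at hrel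
    exact (mul_ne_zero (by simpa using hc₀) (hg k₀)) hrel
  obtain ⟨k₁, hk₁, hne⟩ := hex
  refine ⟨k₁, hk₁, k₀, hk₀, hne, ?_⟩
  have hd1 := sub_eq_zero.1 (hdz k₁ (Finset.mem_erase.2 ⟨hne, hk₁⟩))
  have hc1 : algebraMap K L (c k₁) ≠ 0 := by simpa using hz k₁ hk₁
  have hc0 : algebraMap K L (c k₀) ≠ 0 := by simpa using hc₀
  have hu0 : algebraMap K L (u k₀) ≠ 0 := by
    intro h0
    have := hu k₀
    rw [h0, zero_mul] at this
    exact pow_ne_zero _ (hg k₀) this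
  -- The quotient of two terms is fixed by Frobenius, hence lies in the prime field and so in `K`.
  set t : L := algebraMap K L (c k₁) * g k₁ / (algebraMap K L (c k₀) * g k₀) with ht
  have htp : t ^ p = t := by
    have h1 := congrArg (algebraMap K L) hd1
    simp only [map_mul, map_pow] at h1
    rw [ht, div_pow, mul_pow, mul_pow, hu, hu, div_eq_div_iff
      (mul_ne_zero (pow_ne_zero _ hc0) (mul_ne_zero hu0 (hg k₀))) (mul_ne_zero hc0 (hg k₀))]
    linear_combination g k₁ * g k₀ * h1
  have hmem := (Subfield.mem_bot_iff_pow_eq_self (F := L) (p := p)).2 htp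
  obtain ⟨s, hs⟩ := (bot_le : (⊥ : Subfield L) ≤ (algebraMap K L).fieldRange) hmem
  refine ⟨s * c k₀ / c k₁, ?_⟩
  rw [map_div₀, map_mul, hs, ht]
  field_simp [hg k₀]

open PowerSeries in
-- Over the prime field `f(X)^p = f(X^p)`; truncation reduces this to polynomials.
theorem coeff_pow_char {p : ℕ} [Fact p.Prime] (f : (ZMod p)⟦X⟧) (n : ℕ) :
    coeff n (f ^ p) = if p ∣ n then coeff (n / p) f else 0 := by
  have hp : p.Prime := Fact.out
  rw [← coeff_coe_trunc_of_lt (n := n) (m := n + 1) (f := f ^ p) (by omega), ← trunc_trunc_pow,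
    coeff_coe_trunc_of_lt (by omega), ← Polynomial.coe_pow, Polynomial.coeff_coe,
    ← ZMod.expand_card, Polynomial.coeff_expand hp.pos]
  split_ifs
  · rw [coeff_trunc, if_pos (Nat.lt_succ_of_le (Nat.div_le_self _ _))]
  · rfl

open PowerSeries in
/-- The functional equation of a power series whose coefficients satisfy a Lucas congruence. -/
theorem eq_trunc_mul_pow_of_lucas {p : ℕ} [Fact p.Prime] (f : (ZMod p)⟦X⟧)
    (hf : ∀ n m, m < p → coeff (n * p + m) f = coeff n f * coeff m f) :
    f = (trunc p f : Polynomial (ZMod p)) * f ^ p := by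
  have hp : p.Prime := Fact.out
  ext n
  have hn : n / p * p + n % p = n := Nat.div_add_mod' n p
  have hlt : n % p < p := Nat.mod_lt _ hp.pos
  have hn' : n % p + n / p * p = n := by omega
  -- The truncation has only exponents below `p` and `f ^ p` only multiples of `p`, so division with
  -- remainder leaves a single term of the convolution.
  rw [coeff_mul, Finset.sum_eq_single (n % p, n / p * p)]
  · dsimp only
    rw [Polynomial.coeff_coe, coeff_trunc, if_pos hlt, coeff_pow_char,
      if_pos (Dvd.intro_left _ rfl), Nat.mul_div_cancel _ hp.pos, mul_comm, ← hf _ _ hlt, hn]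
  · rintro ⟨i, j⟩ hij hne
    rw [Finset.HasAntidiagonal.mem_antidiagonal] at hij
    dsimp only at hij ⊢
    rw [Polynomial.coeff_coe, coeff_trunc, coeff_pow_char]
    split_ifs with h1 h2
    · obtain ⟨q, rfl⟩ := h2
      exfalso; apply hne
      have e1 : n % p = i := by
        rw [← hij, Nat.add_mul_mod_self_left, Nat.mod_eq_of_lt h1]
      have e2 : n / p = q := by
        rw [← hij, Nat.add_mul_div_left _ _ hp.pos, Nat.div_eq_of_lt h1, zero_add]
      rw [e1, e2, mul_comm]
    all_goals simp
  · intro h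
    exact absurd (Finset.HasAntidiagonal.mem_antidiagonal.2 hn') h

/-- A power series monomial `∏ f i ^ m i`. -/
noncomputable def seriesMonomial {ι R : Type*} [CommSemiring R] (f : ι → PowerSeries R)
    (m : ι →₀ ℕ) : PowerSeries R := m.prod fun i k => f i ^ k

theorem map_seriesMonomial {ι R S : Type*} [CommSemiring R] [CommSemiring S] (φ : R →+* S)
    (f : ι → PowerSeries R) (m : ι →₀ ℕ) :
    PowerSeries.map φ (seriesMonomial f m) = seriesMonomial (fun i => PowerSeries.map φ (f i)) m := by
  simp [seriesMonomial, Finsupp.prod]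

/-- Coprimality forces `a ^ d` to divide `A`. With `d = p - 1` and `A` a product of at most `N`
truncations this gives a bound free of `p`. -/
theorem natDegree_le_of_pow_dvd {F : Type*} [Field F] {a b A : Polynomial F} (hab : IsCoprime a b)
    {d N : ℕ} (hd : 0 < d) (hA : A ≠ 0) (hAN : A.natDegree ≤ d * N) (h : a ^ d ∣ b ^ d * A) :
    a.natDegree ≤ N := by
  have h1 : a ^ d ∣ A := (hab.pow (m := d) (n := d)).dvd_of_dvd_mul_left h
  have h2 := Polynomial.natDegree_le_of_dvd h1 hA
  rw [Polynomial.natDegree_pow] at h2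
  exact Nat.le_of_mul_le_mul_left (h2.trans hAN) hd

open PowerSeries in
/-- Over `ZMod p`, a relation between monomials in Lucas series produces a proportionality between
two of the monomials, with coefficients of bounded degree. -/
theorem exists_zmod_proportional {ι : Type*} {p : ℕ} [Fact p.Prime] (f : ι → (ZMod p)⟦X⟧)
    (hf0 : ∀ i, constantCoeff (f i) = 1)
    (hf : ∀ i n m, m < p → coeff (n * p + m) (f i) = coeff n (f i) * coeff m (f i))
    (T : Finset (ι →₀ ℕ)) (N : ℕ) (hN : ∀ m ∈ T, m.degree ≤ N)
    (c : (ι →₀ ℕ) → Polynomial (ZMod p)) (hc : ∃ m ∈ T, c m ≠ 0)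
    (hrel : ∑ m ∈ T, (c m : (ZMod p)⟦X⟧) * seriesMonomial f m = 0) :
    ∃ k ∈ T, ∃ l ∈ T, k ≠ l ∧ ∃ a b : Polynomial (ZMod p), a ≠ 0 ∧ a.natDegree ≤ N ∧
      b.natDegree ≤ N ∧ (a : (ZMod p)⟦X⟧) * seriesMonomial f k = b * seriesMonomial f l := by
  classical
  have hp : p.Prime := Fact.out
  obtain ⟨q, rfl⟩ : ∃ q, p = q + 1 := ⟨p - 1, by have := hp.pos; omega⟩
  have hq : 0 < q := by have := hp.two_le; omega
  let A : (ι →₀ ℕ) → Polynomial (ZMod (q + 1)) := fun m => m.prod fun i k => (trunc (q + 1) (f i)) ^ k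
  have hg : ∀ m, seriesMonomial f m = A m * seriesMonomial f m ^ (q + 1) := by
    intro m
    have hA : ((A m : Polynomial (ZMod (q + 1))) : (ZMod (q + 1))⟦X⟧) =
        m.prod fun i k => ((trunc (q + 1) (f i) : Polynomial (ZMod (q + 1))) :
          (ZMod (q + 1))⟦X⟧) ^ k := by
      simp only [A, Finsupp.prod]
      rw [← Polynomial.coeToPowerSeries.ringHom_apply, map_prod]
      simp
    rw [hA]
    simp only [seriesMonomial, Finsupp.prod]
    rw [← Finset.prod_pow, ← Finset.prod_mul_distrib]
    refine Finset.prod_congr rfl fun i _ => ?_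
    conv_lhs => rw [eq_trunc_mul_pow_of_lucas (f i) (hf i)]
    ring
  have hg0 : ∀ m, seriesMonomial f m ≠ 0 := by
    intro m h0
    have h1 := congrArg constantCoeff h0
    simp [seriesMonomial, Finsupp.prod, hf0] at h1
  have hA0 : ∀ m, A m ≠ 0 := by
    intro m h0
    have := hg m
    rw [h0, Polynomial.coe_zero, zero_mul] at this
    exact hg0 m this
  have hg1 : ∀ m, (A m : (ZMod (q + 1))⟦X⟧) * seriesMonomial f m ^ q = 1 := by
    intro m
    have := hg m
    apply mul_right_cancel₀ (hg0 m)
    rw [one_mul, mul_assoc, ← pow_succ]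
    exact this.symm
  have hdeg : ∀ m ∈ T, (A m).natDegree ≤ q * N := by
    intro m hm
    simp only [A, Finsupp.prod]
    refine (Polynomial.natDegree_prod_le _ _).trans ?_
    calc ∑ i ∈ m.support, ((trunc (q + 1) (f i)) ^ m i).natDegree
        ≤ ∑ i ∈ m.support, q * m i := by
          refine Finset.sum_le_sum fun i _ => ?_
          rw [Polynomial.natDegree_pow, mul_comm]
          exact Nat.mul_le_mul_right _ (Nat.lt_succ_iff.1 (natDegree_trunc_lt (f i) q))
      _ = q * m.degree := by rw [← Finset.mul_sum]; rfl
      _ ≤ q * N := Nat.mul_le_mul_left _ (hN m hm)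
  let φ : (ZMod (q + 1))⟦X⟧ →+* (ZMod (q + 1))⸨X⸩ := HahnSeries.ofPowerSeries ℤ (ZMod (q + 1))
  have hφ : Function.Injective φ := HahnSeries.ofPowerSeries_injective
  have hcoe : ∀ P : Polynomial (ZMod (q + 1)), φ P = algebraMap (RatFunc (ZMod (q + 1)))
      (ZMod (q + 1))⸨X⸩ (algebraMap _ _ P) := fun P => RatFunc.coe_coe P
  have : CharP (ZMod (q + 1))⸨X⸩ (q + 1) :=
    charP_of_injective_ringHom (f := φ.comp PowerSeries.C) (RingHom.injective _) (q + 1)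
  obtain ⟨k, hk, l, hl, hne, e, he⟩ := exists_proportional_of_relation (K := RatFunc (ZMod (q + 1)))
    (q + 1) (fun m => φ (seriesMonomial f m)) (fun m => (algebraMap _ _ (A m))⁻¹)
    (fun m => (map_ne_zero_iff _ hφ).2 (hg0 m))
    (fun m => by
      rw [map_inv₀, ← hcoe, eq_inv_mul_iff_mul_eq₀ ((map_ne_zero_iff _ hφ).2 (by simpa using hA0 m)),
        ← map_pow, ← map_mul, ← hg])
    T (fun m => algebraMap _ _ (c m))
    (by obtain ⟨m, hm, h⟩ := hc
        exact ⟨m, hm, by simpa using h⟩)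
    (by
      have h1 := congrArg φ hrel
      rw [map_sum, map_zero] at h1
      rw [← h1]
      exact Finset.sum_congr rfl fun m _ => by rw [map_mul, hcoe])
  have hab : (e.denom : (ZMod (q + 1))⟦X⟧) * seriesMonomial f k = e.num * seriesMonomial f l := by
    apply hφ
    rw [map_mul, map_mul, he, hcoe, hcoe, ← mul_assoc, ← map_mul]
    congr 2
    nth_rewrite 2 [← RatFunc.num_div_denom e]
    rw [mul_div_cancel₀]
    simpa using e.denom_ne_zero
  -- Raise the proportionality to the power `q = p - 1` and use `A m * g ^ q = 1` for both
  -- monomials.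
  have hpow : e.denom ^ q * A l = e.num ^ q * A k := by
    apply Polynomial.coe_injective
    push_cast
    have h1 := congrArg (· ^ q) hab
    simp only [mul_pow] at h1
    linear_combination (A k * A l : (ZMod (q + 1))⟦X⟧) * h1 -
      (e.denom : (ZMod (q + 1))⟦X⟧) ^ q * A l * hg1 k + (e.num : (ZMod (q + 1))⟦X⟧) ^ q * A k * hg1 l
  have hcop := e.isCoprime_num_denom
  exact ⟨k, hk, l, hl, hne, e.denom, e.num, e.denom_ne_zero,
    natDegree_le_of_pow_dvd hcop.symm hq (hA0 k) (hdeg k hk) ⟨A l, hpow.symm⟩,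
    natDegree_le_of_pow_dvd hcop hq (hA0 l) (hdeg l hl) ⟨A k, hpow⟩, hab⟩

/-! ### Descent of polynomial relations and the pigeonhole over primes. -/

/-- The polynomials with prescribed coefficients of degree less than `D`. -/
noncomputable def polyOfCoeffs {R κ : Type*} [Semiring R] {D : ℕ} (c : κ × Fin D → R) (k : κ) :
    Polynomial R := ∑ j : Fin D, Polynomial.monomial j (c (k, j))

theorem polyOfCoeffs_coeff {R κ : Type*} [Semiring R] {D : ℕ} (c : κ × Fin D → R) (k : κ)
    (j : Fin D) : (polyOfCoeffs c k).coeff j = c (k, j) := by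
  classical
  simp [polyOfCoeffs, Polynomial.coeff_monomial, Fin.val_inj]

theorem polyOfCoeffs_of_natDegree_lt {R κ : Type*} [Semiring R] {D : ℕ} (P : κ → Polynomial R)
    (k : κ) (h : (P k).natDegree < D) :
    polyOfCoeffs (fun x : κ × Fin D => (P x.1).coeff x.2) k = P k := by
  rw [polyOfCoeffs, (P k).as_sum_range' D h,
    ← Fin.sum_univ_eq_sum_range (fun j => Polynomial.monomial j ((P k).coeff j))]

open PowerSeries in
theorem coeff_sum_polyOfCoeffs {R κ : Type*} [CommRing R] [Fintype κ] (M : κ → ℤ⟦X⟧) {D : ℕ}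
    (c : κ × Fin D → R) (n : ℕ) :
    coeff n (∑ k, (polyOfCoeffs c k : R⟦X⟧) * map (Int.castRingHom R) (M k)) =
      ∑ x : κ × Fin D, c x * ((coeff n (X ^ (x.2 : ℕ) * M x.1) : ℤ) : R) := by
  rw [map_sum, Fintype.sum_prod_type]
  refine Finset.sum_congr rfl fun k _ => ?_
  rw [polyOfCoeffs, ← Polynomial.coeToPowerSeries.ringHom_apply, map_sum, Finset.sum_mul, map_sum]
  refine Finset.sum_congr rfl fun j _ => ?_
  rw [Polynomial.coeToPowerSeries.ringHom_apply, Polynomial.coe_monomial, show (monomial (j : ℕ) (c (k, j)) : R⟦X⟧) =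
    C (c (k, j)) * X ^ (j : ℕ) by rw [X_pow_eq, ← monomial_zero_eq_C_apply, monomial_mul_monomial,
      zero_add, mul_one], mul_assoc, coeff_C_mul]
  congr 1
  have : (X ^ (j : ℕ) * map (Int.castRingHom R) (M k) : R⟦X⟧) =
      map (Int.castRingHom R) (X ^ (j : ℕ) * M k) := by simp
  rw [this, coeff_map]; rfl

open PowerSeries in
theorem exists_zmod_poly_relation {κ : Type*} [Fintype κ] (M : κ → ℤ⟦X⟧) (c : κ → Polynomial ℂ)
    (hc : c ≠ 0) (hrel : ∑ k, (c k : ℂ⟦X⟧) * map (Int.castRingHom ℂ) (M k) = 0) (p : ℕ)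
    (hp : p.Prime) : ∃ d : κ → Polynomial (ZMod p), d ≠ 0 ∧
      ∑ k, (d k : (ZMod p)⟦X⟧) * map (Int.castRingHom (ZMod p)) (M k) = 0 := by
  set D := (∑ k, (c k).natDegree) + 1 with hD
  have hlt : ∀ k, (c k).natDegree < D := fun k => Nat.lt_succ_of_le
    (Finset.single_le_sum (f := fun k => (c k).natDegree) (fun _ _ => Nat.zero_le _)
      (Finset.mem_univ k))
  obtain ⟨d, hd, h⟩ := exists_zmod_relation
    (fun (x : κ × Fin D) n => coeff n (X ^ (x.2 : ℕ) * M x.1)) (fun x => (c x.1).coeff x.2)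
    (by
      obtain ⟨k, hk⟩ := Function.ne_iff.1 hc
      refine Function.ne_iff.2 ⟨(k, ⟨(c k).natDegree, hlt k⟩), ?_⟩
      simpa using hk)
    (fun n => by
      rw [← coeff_sum_polyOfCoeffs M (fun x : κ × Fin D => (c x.1).coeff x.2)]
      simp only [polyOfCoeffs_of_natDegree_lt c _ (hlt _), hrel, map_zero]) p hp
  refine ⟨polyOfCoeffs d, fun h0 => hd ?_, ?_⟩
  · ext ⟨k, j⟩
    rw [← polyOfCoeffs_coeff d, h0]; simp
  · ext n
    rw [coeff_sum_polyOfCoeffs, h, map_zero]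

open PowerSeries in
-- The bound `N` does not depend on `p`, so all the relations concern the same finite family of
-- shifted sequences and `exists_rat_relation` applies.
theorem exists_rat_poly_relation {κ : Type*} [Fintype κ] (M : κ → ℤ⟦X⟧) (N : ℕ)
    (hS : {p : ℕ | p.Prime ∧ ∃ d : κ → Polynomial (ZMod p), d ≠ 0 ∧ (∀ k, (d k).natDegree ≤ N) ∧
      ∑ k, (d k : (ZMod p)⟦X⟧) * map (Int.castRingHom (ZMod p)) (M k) = 0}.Infinite) :
    ∃ c : κ → Polynomial ℚ, c ≠ 0 ∧
      ∑ k, (c k : ℚ⟦X⟧) * map (Int.castRingHom ℚ) (M k) = 0 := by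
  obtain ⟨c, hc, h⟩ := exists_rat_relation
    (fun (x : κ × Fin (N + 1)) n => coeff n (X ^ (x.2 : ℕ) * M x.1)) (hS.mono (by
      rintro p ⟨hp, d, hd, hdN, hrel⟩
      refine ⟨hp, fun x => (d x.1).coeff x.2, ?_, fun n => ?_⟩
      · obtain ⟨k, hk⟩ := Function.ne_iff.1 hd
        refine Function.ne_iff.2 ⟨(k, ⟨(d k).natDegree, Nat.lt_succ_of_le (hdN k)⟩), ?_⟩
        simpa using hk
      · rw [← coeff_sum_polyOfCoeffs M (fun x : κ × Fin (N + 1) => (d x.1).coeff x.2)]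
        simp only [polyOfCoeffs_of_natDegree_lt d _ (Nat.lt_succ_of_le (hdN _)), hrel, map_zero]))
  refine ⟨polyOfCoeffs c, fun h0 => hc ?_, ?_⟩
  · ext ⟨k, j⟩
    rw [← polyOfCoeffs_coeff c, h0]; simp
  · ext n
    rw [coeff_sum_polyOfCoeffs, h, map_zero]

theorem exists_poly_relation_of_not_algebraicIndependent {ι F : Type*} [Field F]
    (f : ι → PowerSeries F)
    (h : ¬ AlgebraicIndependent (RatFunc F)
      (fun i => (HahnSeries.ofPowerSeries ℤ F (f i) : LaurentSeries F))) :
    ∃ (T : Finset (ι →₀ ℕ)) (c : (ι →₀ ℕ) → Polynomial F), (∃ m ∈ T, c m ≠ 0) ∧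
      ∑ m ∈ T, (c m : PowerSeries F) * seriesMonomial f m = 0 := by
  classical
  rw [algebraicIndependent_iff] at h
  push Not at h
  obtain ⟨P, hP, hP0⟩ := h
  obtain ⟨b, hb⟩ := IsLocalization.exist_integer_multiples_of_finset
    (nonZeroDivisors (Polynomial F)) (P.support.image P.coeff)
  have hb' : ∀ m, ∃ z : Polynomial F,
      algebraMap _ (RatFunc F) z = algebraMap _ (RatFunc F) (b : Polynomial F) * P.coeff m := by
    intro m
    by_cases hm : m ∈ P.support
    · obtain ⟨z, hz⟩ := hb _ (Finset.mem_image_of_mem _ hm)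
      exact ⟨z, by rw [hz, Algebra.smul_def]⟩
    · exact ⟨0, by simp [MvPolynomial.notMem_support_iff.1 hm]⟩
  choose z hz using hb'
  have hb0 : algebraMap _ (RatFunc F) (b : Polynomial F) ≠ 0 := by
    simp
  refine ⟨P.support, z, ?_, ?_⟩
  · obtain ⟨m, hm⟩ := MvPolynomial.support_nonempty.2 hP0
    refine ⟨m, hm, fun h0 => ?_⟩
    have := hz m
    rw [h0, map_zero] at this
    exact mul_ne_zero hb0 (MvPolynomial.mem_support_iff.1 hm) this.symm
  · apply HahnSeries.ofPowerSeries_injective (Γ := ℤ)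
    rw [map_sum, map_zero]
    have h1 : ∀ m, HahnSeries.ofPowerSeries ℤ F ((z m : PowerSeries F) * seriesMonomial f m) =
        algebraMap (RatFunc F) F⸨X⸩ (algebraMap _ (RatFunc F) (b : Polynomial F)) *
          (algebraMap (RatFunc F) F⸨X⸩ (P.coeff m) *
            ∏ i ∈ m.support, (HahnSeries.ofPowerSeries ℤ F (f i)) ^ m i) := by
      intro m
      rw [map_mul, RatFunc.coe_coe, ← mul_assoc, ← map_mul, ← hz]
      simp [seriesMonomial, Finsupp.prod]
    simp only [h1]
    rw [← Finset.mul_sum, ← MvPolynomial.eval₂_eq, ← MvPolynomial.aeval_def, hP, mul_zero]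

open PowerSeries in
/-- Algebraically dependent power series with integer coefficients that satisfy Lucas congruences
modulo all primes are multiplicatively dependent modulo rational functions. -/
theorem exists_proportional_monomials_of_lucas {ι : Type*} (f : ι → ℤ⟦X⟧)
    (hf0 : ∀ i, constantCoeff (f i) = 1)
    (hf : ∀ p : ℕ, p.Prime → ∀ i n m, m < p → ((coeff (n * p + m) (f i) : ℤ) : ZMod p) =
      (coeff n (f i) : ℤ) * (coeff m (f i) : ℤ))
    (h : ¬ AlgebraicIndependent (RatFunc ℂ)
      (fun i => (HahnSeries.ofPowerSeries ℤ ℂ (map (Int.castRingHom ℂ) (f i)) : LaurentSeries ℂ))) :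
    ∃ k l : ι →₀ ℕ, k ≠ l ∧ ∃ P Q : Polynomial ℚ, (P ≠ 0 ∨ Q ≠ 0) ∧
      (P : ℚ⟦X⟧) * seriesMonomial (fun i => map (Int.castRingHom ℚ) (f i)) k =
        Q * seriesMonomial (fun i => map (Int.castRingHom ℚ) (f i)) l := by
  classical
  obtain ⟨T, c, ⟨m₀, hm₀, hc⟩, hrel⟩ := exists_poly_relation_of_not_algebraicIndependent _ h
  set N := T.sup Finsupp.degree with hN
  have hrel' : ∑ m : T, (c m : ℂ⟦X⟧) * map (Int.castRingHom ℂ) (seriesMonomial f m) = 0 := by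
    simp only [map_seriesMonomial]
    rw [← hrel]
    exact Finset.sum_coe_sort T fun m => (c m : ℂ⟦X⟧) *
      seriesMonomial (fun i => map (Int.castRingHom ℂ) (f i)) m
  have hp : ∀ p : ℕ, p.Prime → ∃ x ∈ T ×ˢ T, x.1 ≠ x.2 ∧ ∃ a b : Polynomial (ZMod p), a ≠ 0 ∧
      a.natDegree ≤ N ∧ b.natDegree ≤ N ∧
      (a : (ZMod p)⟦X⟧) * map (Int.castRingHom (ZMod p)) (seriesMonomial f x.1) =
        b * map (Int.castRingHom (ZMod p)) (seriesMonomial f x.2) := by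
    intro p hp
    have := Fact.mk hp
    obtain ⟨d, hd, hdrel⟩ := exists_zmod_poly_relation (fun m : T => seriesMonomial f m)
      (fun m => c m) (fun h0 => hc (congrFun h0 ⟨m₀, hm₀⟩)) hrel' p hp
    obtain ⟨m₁, hm₁⟩ := Function.ne_iff.1 hd
    obtain ⟨k, hk, l, hl, hne, a, b, ha, haN, hbN, hab⟩ := exists_zmod_proportional
      (fun i => map (Int.castRingHom (ZMod p)) (f i))
      (fun i => by rw [← coeff_zero_eq_constantCoeff_apply, coeff_map,
        coeff_zero_eq_constantCoeff_apply, hf0]; simp)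
      (fun i n m hm => by simpa using hf p hp i n m hm) T N
      (fun m hm => Finset.le_sup (f := Finsupp.degree) hm)
      (fun m => if hm : m ∈ T then d ⟨m, hm⟩ else 0)
      ⟨m₁, m₁.2, by simpa using hm₁⟩ (by
        rw [← hdrel, ← Finset.sum_coe_sort]
        refine Finset.sum_congr rfl fun m _ => ?_
        rw [map_seriesMonomial]
        simp)
    refine ⟨(k, l), Finset.mem_product.2 ⟨hk, hl⟩, hne, a, b, ha, haN, hbN, ?_⟩
    simp only [map_seriesMonomial]
    exact hab
  let S : (ι →₀ ℕ) × (ι →₀ ℕ) → Set ℕ := fun x => {p | p.Prime ∧ x.1 ≠ x.2 ∧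
    ∃ a b : Polynomial (ZMod p), a ≠ 0 ∧ a.natDegree ≤ N ∧ b.natDegree ≤ N ∧
      (a : (ZMod p)⟦X⟧) * map (Int.castRingHom (ZMod p)) (seriesMonomial f x.1) =
        b * map (Int.castRingHom (ZMod p)) (seriesMonomial f x.2)}
  -- Pigeonhole: finitely many pairs of monomials serve infinitely many primes.
  obtain ⟨⟨k, l⟩, -, hinf⟩ : ∃ x ∈ T ×ˢ T, (S x).Infinite := by
    by_contra! hall
    refine Nat.infinite_setOfPred_prime (Set.Finite.subset
      (Set.Finite.biUnion (T ×ˢ T).finite_toSet fun x hx => hall x hx) ?_)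
    intro p hpp
    obtain ⟨x, hx, h1⟩ := hp p hpp
    exact Set.mem_biUnion (Finset.mem_coe.2 hx) ⟨hpp, h1⟩
  obtain ⟨p, -, hne, -⟩ := hinf.nonempty
  obtain ⟨c, hc, hrel⟩ := exists_rat_poly_relation
    (fun b : Bool => cond b (seriesMonomial f k) (seriesMonomial f l)) N (hinf.mono (by
      rintro p ⟨hp, -, a, b, ha, haN, hbN, hab⟩
      refine ⟨hp, fun x => cond x a (-b), fun h0 => ha (congrFun h0 true), ?_, ?_⟩
      · rintro (_ | _)
        · simpa using hbN
        · exact haN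
      · rw [Fintype.sum_bool]
        simp only [cond_true, cond_false, Polynomial.coe_neg, hab]
        ring))
  refine ⟨k, l, hne, c true, -c false, ?_, ?_⟩
  · by_contra! h0
    refine hc (funext ?_)
    rintro (_ | _)
    · simpa using h0.2
    · exact h0.1
  · rw [Fintype.sum_bool] at hrel
    simp only [cond_true, cond_false, map_seriesMonomial] at hrel
    rw [Polynomial.coe_neg]
    linear_combination hrel

/-! ### Growth of the coefficients. -/

/-- The central coefficient dominates. This saves the factor `n + 1` needed for the sum of cubes of
binomials. -/
theorem choose_sq_mul_le (n k : ℕ) : n.choose k ^ 2 * (n + 1) ≤ 4 ^ n := by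
  have hc : ∀ m : ℕ, (2 * m + 1) * m.centralBinom ^ 2 ≤ 16 ^ m := by
    intro m
    induction m with
    | zero => simp
    | succ m ih =>
      have h := Nat.succ_mul_centralBinom_succ m
      refine Nat.le_of_mul_le_mul_left (?_ : (m + 1) ^ 2 * _ ≤ (m + 1) ^ 2 * _) (by positivity)
      calc (m + 1) ^ 2 * ((2 * (m + 1) + 1) * (m + 1).centralBinom ^ 2)
          = (2 * m + 3) * ((m + 1) * (m + 1).centralBinom) ^ 2 := by ring
        _ = (4 * (2 * m + 3) * (2 * m + 1)) * ((2 * m + 1) * m.centralBinom ^ 2) := by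
          rw [h]; ring
        _ ≤ (16 * (m + 1) ^ 2) * 16 ^ m := Nat.mul_le_mul (by nlinarith) ih
        _ = (m + 1) ^ 2 * 16 ^ (m + 1) := by ring
  have hmid : n.choose k ^ 2 * (n + 1) ≤ n.choose (n / 2) ^ 2 * (n + 1) :=
    Nat.mul_le_mul_right _ (Nat.pow_le_pow_left (Nat.choose_le_middle k n) 2)
  refine hmid.trans ?_
  obtain ⟨m, rfl | rfl⟩ := Nat.even_or_odd' n
  · rw [Nat.mul_div_cancel_left _ two_pos, pow_mul, ← Nat.centralBinom_eq_two_mul_choose]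
    norm_num
    linarith [hc m]
  · have h1 : (2 * m + 1) / 2 = m := by omega
    have h2 : (m + 1).centralBinom = 2 * (2 * m + 1).choose m := by
      rw [Nat.centralBinom_eq_two_mul_choose, show 2 * (m + 1) = (2 * m + 1) + 1 by ring,
        Nat.choose_succ_succ, Nat.choose_symm_half]; ring
    have h3 := hc (m + 1)
    rw [h2, pow_succ 16 m] at h3
    rw [h1, pow_succ 4 (2 * m), pow_mul]
    norm_num
    nlinarith [Nat.zero_le (((2 * m + 1).choose m) ^ 2)]

/-- `1 / (n - k)!`, extended by zero to `k > n`. -/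
noncomputable def invFactorialSub (n k : ℕ) : ℝ := if k ≤ n then ((n - k).factorial : ℝ)⁻¹ else 0

theorem invFactorialSub_succ_succ (n k : ℕ) :
    invFactorialSub (n + 1) (k + 1) = invFactorialSub n k := by
  simp [invFactorialSub]

/-- Extension by zero keeps this valid at `k = n + 1`, where the linear factor vanishes, so the
telescoping below needs no boundary cases. -/
theorem invFactorialSub_eq_mul (n k : ℕ) :
    invFactorialSub n k = ((n : ℝ) + 1 - k) * invFactorialSub (n + 1) k := by
  unfold invFactorialSub
  rcases lt_trichotomy k (n + 1) with h | rfl | h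
  · obtain ⟨d, rfl⟩ := Nat.exists_eq_add_of_le (Nat.le_of_lt_succ h)
    rw [if_pos (by omega), if_pos (by omega), show k + d - k = d by omega,
      show k + d + 1 - k = d + 1 by omega, Nat.factorial_succ]
    have := Nat.factorial_ne_zero d
    push_cast
    field_simp
    ring
  · simp
  · rw [if_neg (by omega), if_neg (by omega), mul_zero]

theorem choose_eq_invFactorialSub (n k : ℕ) :
    (n.choose k : ℝ) = n.factorial * (k.factorial : ℝ)⁻¹ * invFactorialSub n k := by
  unfold invFactorialSub
  split_ifs with h
  · rw [Nat.cast_choose ℝ h]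
    field_simp
  · rw [Nat.choose_eq_zero_of_lt (by omega)]; simp

theorem choose_mul_choose_add_eq (n k : ℕ) :
    (n.choose k : ℝ) * ((n + k).choose k : ℝ) =
      (n + k).factorial * (k.factorial : ℝ)⁻¹ ^ 2 * invFactorialSub n k := by
  rw [choose_eq_invFactorialSub, add_comm n k, Nat.cast_add_choose]
  have := Nat.factorial_ne_zero n
  field_simp

theorem choose_sq_mul_choose_add_eq (n k : ℕ) :
    (n.choose k : ℝ) ^ 2 * ((n + k).choose k : ℝ) =
      n.factorial * (n + k).factorial * (k.factorial : ℝ)⁻¹ ^ 3 * invFactorialSub n k ^ 2 := by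
  rw [pow_two, mul_assoc, choose_mul_choose_add_eq, choose_eq_invFactorialSub]
  ring

theorem cast_binomSum_two_two (n N : ℕ) (h : n + 1 ≤ N) : (binomSum 2 2 n : ℝ) =
    ∑ k ∈ Finset.range N, ((n + k).factorial * (k.factorial : ℝ)⁻¹ ^ 2 * invFactorialSub n k) ^ 2 := by
  rw [binomSum_eq_sum_range two_ne_zero 2 h]
  push_cast
  refine Finset.sum_congr rfl fun k _ => ?_
  rw [← choose_mul_choose_add_eq]; ring

theorem cast_binomSum_two_one (n N : ℕ) (h : n + 1 ≤ N) : (binomSum 2 1 n : ℝ) =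
    ∑ k ∈ Finset.range N, (n.factorial * (n + k).factorial * (k.factorial : ℝ)⁻¹ ^ 3 *
      invFactorialSub n k ^ 2) := by
  rw [binomSum_eq_sum_range two_ne_zero 1 h]
  push_cast
  refine Finset.sum_congr rfl fun k _ => ?_
  rw [← choose_sq_mul_choose_add_eq]; ring

/-- Apéry's recurrence for `ζ(3)`. -/
theorem binomSum_two_two_recurrence (n : ℕ) :
    ((n : ℝ) + 2) ^ 3 * binomSum 2 2 (n + 2) =
      (34 * ((n : ℝ) + 1) ^ 3 + 51 * ((n : ℝ) + 1) ^ 2 + 27 * ((n : ℝ) + 1) + 5) *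
        binomSum 2 2 (n + 1) - ((n : ℝ) + 1) ^ 3 * binomSum 2 2 n := by
  -- The creative-telescoping certificate: a polynomial times the summand at `(n + 1, k - 1)`, where
  -- `k ^ 2 / k! ^ 2` stands for `1 / (k - 1)! ^ 2` and gives zero at `k = 0`.
  let D : ℕ → ℝ := fun k => 4 * (2 * n + 3) * (((k : ℝ) - 1) * (2 * k - 1) - (2 * n + 3) ^ 2) *
    ((n + k).factorial * k ^ 2 * (k.factorial : ℝ)⁻¹ ^ 2 * invFactorialSub (n + 2) k) ^ 2
  have hsum := Finset.sum_range_sub D (n + 3)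
  have hD : D (n + 3) - D 0 = 0 := by simp [D, invFactorialSub]
  rw [cast_binomSum_two_two n (n + 3) (by omega), cast_binomSum_two_two (n + 1) (n + 3) (by omega),
    cast_binomSum_two_two (n + 2) (n + 3) (by omega)]
  rw [← sub_eq_zero, ← hD, ← hsum]
  rw [Finset.mul_sum, Finset.mul_sum, Finset.mul_sum, ← Finset.sum_sub_distrib,
    ← Finset.sum_sub_distrib]
  refine Finset.sum_congr rfl fun k _ => ?_
  have e1 : n + (k + 1) = n + k + 1 := by ring
  have e2 : n + 1 + k = n + k + 1 := by ring
  have e3 : n + 2 + k = n + k + 2 := by ring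
  simp only [D, e1, e2, e3, Nat.factorial_succ, invFactorialSub_succ_succ]
  rw [invFactorialSub_eq_mul n k, invFactorialSub_eq_mul (n + 1) k]
  have hk : ((k : ℝ) + 1) ≠ 0 := by positivity
  have hk' := Nat.factorial_ne_zero k
  push_cast
  generalize invFactorialSub (n + 1 + 1) k = c
  generalize ((n + k).factorial : ℝ) = a
  rw [mul_inv, mul_pow ((k : ℝ) + 1)⁻¹]
  have hkk : ((k : ℝ) + 1) ^ 2 * (((k : ℝ) + 1)⁻¹ ^ 2 * ((k.factorial : ℝ)⁻¹) ^ 2) =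
    ((k.factorial : ℝ)⁻¹) ^ 2 := by field_simp
  rw [mul_assoc _ (((k : ℝ) + 1) ^ 2), hkk]
  generalize ((k.factorial : ℝ)⁻¹) = b
  ring

/-- Apéry's recurrence for `ζ(2)`. -/
theorem binomSum_two_one_recurrence (n : ℕ) :
    ((n : ℝ) + 2) ^ 2 * binomSum 2 1 (n + 2) =
      (11 * ((n : ℝ) + 1) ^ 2 + 11 * ((n : ℝ) + 1) + 3) *
        binomSum 2 1 (n + 1) + ((n : ℝ) + 1) ^ 2 * binomSum 2 1 n := by
  -- Again a polynomial times the summand at `(n + 1, k - 1)`.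
  let D : ℕ → ℝ := fun k => (((k : ℝ) - 1) ^ 2 + 3 * (2 * n + 3) * ((k : ℝ) - 1) -
      11 * ((n : ℝ) + 1) ^ 2 - 9 * ((n : ℝ) + 1) - 2) *
    ((n + 1).factorial * (n + k).factorial * (k ^ 3 * (k.factorial : ℝ)⁻¹ ^ 3) *
      invFactorialSub (n + 2) k ^ 2)
  have hsum := Finset.sum_range_sub D (n + 3)
  have hD : D (n + 3) - D 0 = 0 := by simp [D, invFactorialSub]
  rw [cast_binomSum_two_one n (n + 3) (by omega), cast_binomSum_two_one (n + 1) (n + 3) (by omega),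
    cast_binomSum_two_one (n + 2) (n + 3) (by omega)]
  rw [← sub_eq_zero, ← hD, ← hsum]
  rw [Finset.mul_sum, Finset.mul_sum, Finset.mul_sum, ← sub_sub, ← Finset.sum_sub_distrib,
    ← Finset.sum_sub_distrib]
  refine Finset.sum_congr rfl fun k _ => ?_
  have e1 : n + (k + 1) = n + k + 1 := by ring
  have e2 : n + 1 + k = n + k + 1 := by ring
  have e3 : n + 2 + k = n + k + 2 := by ring
  simp only [D, e1, e2, e3, Nat.factorial_succ, invFactorialSub_succ_succ]
  rw [invFactorialSub_eq_mul n k, invFactorialSub_eq_mul (n + 1) k]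
  push_cast
  generalize invFactorialSub (n + 1 + 1) k = c
  generalize ((n + k).factorial : ℝ) = a
  rw [mul_inv, mul_pow ((k : ℝ) + 1)⁻¹]
  have hkk : ((k : ℝ) + 1) ^ 3 * (((k : ℝ) + 1)⁻¹ ^ 3 * ((k.factorial : ℝ)⁻¹) ^ 3) =
    ((k.factorial : ℝ)⁻¹) ^ 3 := by
    have hk : ((k : ℝ) + 1) ≠ 0 := by positivity
    field_simp
  rw [hkk]
  generalize ((k.factorial : ℝ)⁻¹) = b
  generalize (n.factorial : ℝ) = e
  ring

/-- `b n` lies between `lam ^ n` divided by a polynomial and a multiple of `lam ^ n / (n + 1)`. -/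
def GrowthBounds (b : ℕ → ℕ) (lam : ℝ) : Prop :=
  (∃ C : ℝ, ∀ n : ℕ, (b n : ℝ) * (n + 1) ≤ C * lam ^ n) ∧
    ∃ c : ℝ, 0 < c ∧ ∃ K : ℕ, ∀ n : ℕ, c * lam ^ n ≤ ((n : ℝ) + 1) ^ K * b n

/-- It suffices to know the upper bound for one exponent `q`: the remaining `s` factors are each at
most `mu ^ n`. The lower bound follows from the power mean inequality, which loses only a polynomial
factor. -/
theorem growthBounds_sum_pow (t : ℕ → ℕ → ℕ) {lam mu C c : ℝ} {q : ℕ} (K : ℕ)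
    (hmu : 0 ≤ mu) (hc : 0 < c)
    (ht : ∀ n : ℕ, ∀ k ∈ Finset.range (n + 1), (t n k : ℝ) ≤ mu ^ n)
    (hup : ∀ n : ℕ, (∑ k ∈ Finset.range (n + 1), (t n k : ℝ) ^ q) * (n + 1) ≤ C * lam ^ n)
    (hlow : ∀ n : ℕ, c * mu ^ n ≤ ((n : ℝ) + 1) ^ K * ∑ k ∈ Finset.range (n + 1), (t n k : ℝ))
    (hlm : lam = mu ^ q) (s : ℕ) (hqs : q + s ≠ 0) :
    GrowthBounds (fun n => ∑ k ∈ Finset.range (n + 1), t n k ^ (q + s)) (mu ^ (q + s)) := by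
  refine ⟨⟨C, fun n => ?_⟩, c ^ (q + s), by positivity, K * (q + s) + (q + s), fun n => ?_⟩
  · push_cast
    have h1 : ∑ k ∈ Finset.range (n + 1), (t n k : ℝ) ^ (q + s) ≤
        (∑ k ∈ Finset.range (n + 1), (t n k : ℝ) ^ q) * (mu ^ n) ^ s := by
      rw [Finset.sum_mul]
      refine Finset.sum_le_sum fun k hk => ?_
      rw [pow_add]
      have := ht n k hk
      gcongr
    calc _ ≤ (∑ k ∈ Finset.range (n + 1), (t n k : ℝ) ^ q) * (mu ^ n) ^ s * (n + 1) := by gcongr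
      _ = ((∑ k ∈ Finset.range (n + 1), (t n k : ℝ) ^ q) * (n + 1)) * (mu ^ n) ^ s := by ring
      _ ≤ (C * lam ^ n) * (mu ^ n) ^ s := mul_le_mul_of_nonneg_right (hup n) (by positivity)
      _ = C * (mu ^ (q + s)) ^ n := by rw [hlm]; ring
  · push_cast
    obtain ⟨r, hr⟩ := Nat.exists_eq_succ_of_ne_zero hqs
    have h2 := pow_sum_div_card_le_sum_pow (s := Finset.range (n + 1))
      (f := fun k => (t n k : ℝ)) (fun _ _ => by positivity) r
    rw [Finset.card_range, div_le_iff₀ (by positivity)] at h2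
    push_cast at h2
    rw [hr]
    calc c ^ r.succ * (mu ^ r.succ) ^ n = (c * mu ^ n) ^ (r + 1) := by
          rw [Nat.succ_eq_add_one]; ring
      _ ≤ (((n : ℝ) + 1) ^ K * ∑ k ∈ Finset.range (n + 1), (t n k : ℝ)) ^ (r + 1) := by
          exact pow_le_pow_left₀ (by positivity) (hlow n) _
      _ = ((n : ℝ) + 1) ^ (K * (r + 1)) * (∑ k ∈ Finset.range (n + 1), (t n k : ℝ)) ^ (r + 1) := by
          rw [mul_pow, pow_mul]
      _ ≤ ((n : ℝ) + 1) ^ (K * (r + 1)) * ((∑ k ∈ Finset.range (n + 1), (t n k : ℝ) ^ (r + 1)) *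
            ((n : ℝ) + 1) ^ r) := by gcongr
      _ ≤ ((n : ℝ) + 1) ^ (K * (r + 1)) * ((∑ k ∈ Finset.range (n + 1), (t n k : ℝ) ^ (r + 1)) *
            ((n : ℝ) + 1) ^ (r + 1)) := by
          gcongr
          · linarith [(Nat.cast_nonneg n : (0 : ℝ) ≤ n)]
          · omega
      _ = _ := by rw [Nat.succ_eq_add_one]; ring

theorem growthBounds_franel {r : ℕ} (hr : 3 ≤ r) : GrowthBounds (binomSum r 0) (2 ^ r) := by
  obtain ⟨s, rfl⟩ := Nat.exists_eq_add_of_le hr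
  have hsum : ∀ n, ∑ k ∈ Finset.range (n + 1), (n.choose k : ℝ) = 2 ^ n := fun n => by
    exact_mod_cast Nat.sum_range_choose n
  have h := growthBounds_sum_pow (fun n k => n.choose k) (lam := 8) (mu := 2) (C := 1) (c := 1)
    (q := 3) 0 zero_le_two one_pos ?_ ?_ ?_ (by norm_num) s (by omega)
  · have hb : binomSum (3 + s) 0 = fun n => ∑ k ∈ Finset.range (n + 1), n.choose k ^ (3 + s) := by
      funext n; simp [binomSum]
    rwa [hb]
  · intro n k hk
    rw [← hsum n]
    exact Finset.single_le_sum (f := fun k => (n.choose k : ℝ)) (fun _ _ => by positivity) hk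
  · intro n
    calc (∑ k ∈ Finset.range (n + 1), (n.choose k : ℝ) ^ 3) * (n + 1)
        = ∑ k ∈ Finset.range (n + 1), (n.choose k : ℝ) * ((n.choose k : ℝ) ^ 2 * (n + 1)) := by
          rw [Finset.sum_mul]; exact Finset.sum_congr rfl fun _ _ => by ring
      _ ≤ ∑ k ∈ Finset.range (n + 1), (n.choose k : ℝ) * 4 ^ n := by
          refine Finset.sum_le_sum fun k _ => ?_
          gcongr
          exact_mod_cast choose_sq_mul_le n k
      _ = 1 * 8 ^ n := by rw [← Finset.sum_mul, hsum, ← mul_pow]; norm_num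
  · intro n
    rw [hsum]; simp

/-- The recurrence has a negative coefficient, so the ratio of consecutive terms must be controlled:
`(n+1) b(n) / mu^n` decreases and `(n+1)^3 b(n) / mu^n` increases. Here `34 - mu` is the other
characteristic root, `1 / mu`. -/
theorem binomSum_two_two_bounds {mu : ℝ} (hmu : mu ^ 2 = 34 * mu - 1) (h1 : 33.9 ≤ mu)
    (h2 : mu ≤ 34) (n : ℕ) : (binomSum 2 2 n : ℝ) * (n + 1) ≤ mu ^ n ∧
      mu ^ n ≤ ((n : ℝ) + 1) ^ 3 * binomSum 2 2 n := by
  have e0 : binomSum 2 2 0 = 1 := by decide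
  have e1 : binomSum 2 2 1 = 5 := by decide
  have hratio : ∀ n : ℕ, (binomSum 2 2 (n + 1) : ℝ) * (n + 2) ≤ mu * ((n + 1) * binomSum 2 2 n) ∧
      mu * (((n : ℝ) + 1) ^ 3 * binomSum 2 2 n) ≤ ((n : ℝ) + 2) ^ 3 * binomSum 2 2 (n + 1) := by
    intro n
    induction n with
    | zero => rw [e0, e1]; norm_num; constructor <;> linarith
    | succ n ih =>
      have hrec := binomSum_two_two_recurrence n
      obtain ⟨ih1, ih2⟩ := ih
      push_cast
      rw [show (n : ℝ) + 1 + 1 = n + 2 by ring, show (n : ℝ) + 1 + 2 = n + 3 by ring,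
        show n + 1 + 1 = n + 2 by ring]
      have hn : (0 : ℝ) ≤ n := Nat.cast_nonneg n
      have hb : (0 : ℝ) ≤ binomSum 2 2 (n + 1) := Nat.cast_nonneg _
      generalize (n : ℝ) = x at *
      generalize (binomSum 2 2 n : ℝ) = a at *
      generalize (binomSum 2 2 (n + 1) : ℝ) = b at *
      generalize (binomSum 2 2 (n + 2) : ℝ) = c at *
      have hinv : (34 - mu) * mu = 1 := by linear_combination -hmu
      have a1 : (34 - mu) * (b * (x + 2)) ≤ (x + 1) * a := by
        have := mul_le_mul_of_nonneg_left ih1 (sub_nonneg.2 h2)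
        rwa [← mul_assoc (34 - mu) mu, hinv, one_mul] at this
      have a2 : (x + 1) ^ 3 * a ≤ (34 - mu) * ((x + 2) ^ 3 * b) := by
        have := mul_le_mul_of_nonneg_left ih2 (sub_nonneg.2 h2)
        rwa [← mul_assoc (34 - mu) mu, hinv, one_mul] at this
      constructor
      · refine le_of_mul_le_mul_left (?_ : (x + 2) ^ 3 * _ ≤ (x + 2) ^ 3 * _) (by positivity)
        have a3 := mul_le_mul_of_nonneg_left a1 (show 0 ≤ (x + 1) ^ 2 * (x + 3) by positivity)
        have a4 : 0 ≤ (mu * ((x + 1) ^ 3 + 4 * (x + 1) ^ 2 + 4 * (x + 1) + 1) -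
            (17 * (x + 1) ^ 3 + 61 * (x + 1) ^ 2 + 59 * (x + 1) + 10)) * b := by
          refine mul_nonneg ?_ hb
          nlinarith [mul_le_mul_of_nonneg_right h1 (show 0 ≤ (x + 1) ^ 3 + 4 * (x + 1) ^ 2 +
            4 * (x + 1) + 1 by positivity), pow_nonneg hn 2, pow_nonneg hn 3]
        linear_combination a3 + a4 + (x + 3) * hrec
      · refine le_of_mul_le_mul_left (?_ : (x + 2) ^ 3 * _ ≤ (x + 2) ^ 3 * _) (by positivity)
        have a3 := mul_le_mul_of_nonneg_left a2 (show 0 ≤ (x + 3) ^ 3 by positivity)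
        have a4 : 0 ≤ (mu * ((x + 2) ^ 3 * (3 * (x + 1) ^ 2 + 9 * (x + 1) + 7)) -
            (x + 3) ^ 3 * (51 * (x + 1) ^ 2 + 75 * (x + 1) + 29)) * b := by
          refine mul_nonneg ?_ hb
          have a5 := mul_le_mul_of_nonneg_right h1 (show 0 ≤ (x + 2) ^ 3 *
            (3 * (x + 1) ^ 2 + 9 * (x + 1) + 7) by positivity)
          have a6 : 0 ≤ 33.9 * ((x + 2) ^ 3 * (3 * (x + 1) ^ 2 + 9 * (x + 1) + 7)) -
            (x + 3) ^ 3 * (51 * (x + 1) ^ 2 + 75 * (x + 1) + 29) := by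
            ring_nf; positivity
          linarith
        linear_combination a3 + a4 - (x + 3) ^ 3 * hrec
  have hpos : 0 < mu := by linarith
  induction n with
  | zero => simp [e0]
  | succ n ih =>
    obtain ⟨r1, r2⟩ := hratio n
    push_cast
    rw [show (n : ℝ) + 1 + 1 = n + 2 by ring, pow_succ mu]
    constructor
    · nlinarith [ih.1]
    · nlinarith [ih.2]

/-- The recurrence has positive coefficients, and `lam^n / (n+1)` is a supersolution of it while
`lam^n / n` is a subsolution. The constant 4 covers the initial values at 1 and 2. -/
theorem binomSum_two_one_bounds {lam : ℝ} (hlam : lam ^ 2 = 11 * lam + 1) (h1 : 11 ≤ lam)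
    (h2 : lam ≤ 11.1) (n : ℕ) : (binomSum 2 1 n : ℝ) * (n + 1) ≤ lam ^ n ∧
      lam ^ n ≤ 4 * (((n : ℝ) + 1) * binomSum 2 1 n) := by
  have e0 : binomSum 2 1 0 = 1 := by decide
  have e1 : binomSum 2 1 1 = 3 := by decide
  have e2 : binomSum 2 1 2 = 19 := by decide
  have hpos : 0 < lam := by linarith
  constructor
  · induction n using Nat.strong_induction_on with
    | _ n ih =>
    match n with
    | 0 => simp [e0]
    | 1 => rw [e1]; norm_num; linarith
    | n + 2 =>
      have i0 := ih n (by omega)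
      have i1 := ih (n + 1) (by omega)
      have hrec := binomSum_two_one_recurrence n
      have hL : 0 < lam ^ n := by positivity
      have hn : (0 : ℝ) ≤ n := Nat.cast_nonneg n
      rw [pow_succ] at i1
      rw [pow_add, hlam]
      push_cast at i1 ⊢
      generalize (n : ℝ) = x at *
      generalize (binomSum 2 1 n : ℝ) = a at *
      generalize (binomSum 2 1 (n + 1) : ℝ) = b at *
      generalize (binomSum 2 1 (n + 2) : ℝ) = c at *
      generalize lam ^ n = L at *
      refine le_of_mul_le_mul_left (?_ : (x + 2) ^ 3 * _ ≤ (x + 2) ^ 3 * _) (by positivity)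
      have a1 := mul_le_mul_of_nonneg_left i1 (show 0 ≤ (11 * (x + 1) ^ 2 + 11 * (x + 1) + 3) *
        (x + 3) by positivity)
      have a0 := mul_le_mul_of_nonneg_left i0 (show 0 ≤ (x + 1) * (x + 2) * (x + 3) by positivity)
      have a2 : 0 ≤ L * (lam * (8 * (x + 1) + 5) + (x + 1) + 1) := by positivity
      linear_combination a1 + a0 + a2 + (x + 2) * (x + 3) * hrec
  · have key : ∀ n : ℕ, lam ^ (n + 1) ≤ 4 * (((n : ℝ) + 1) * binomSum 2 1 (n + 1)) := by
      intro n
      induction n using Nat.strong_induction_on with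
      | _ n ih =>
      match n with
      | 0 => rw [e1]; norm_num; linarith
      | 1 => rw [e2, hlam]; norm_num; linarith
      | n + 2 =>
        have i0 := ih n (by omega)
        have i1 := ih (n + 1) (by omega)
        have hrec := binomSum_two_one_recurrence (n + 1)
        have hL : 0 < lam ^ (n + 1) := by positivity
        have hn : (0 : ℝ) ≤ n := Nat.cast_nonneg n
        rw [pow_succ] at i1
        rw [show n + 2 + 1 = (n + 1) + 2 by ring, pow_add, hlam]
        push_cast at i1 hrec ⊢
        generalize (n : ℝ) = x at *
        generalize (binomSum 2 1 (n + 1) : ℝ) = a at *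
        rw [show n + 1 + 1 = n + 2 by ring] at *
        generalize (binomSum 2 1 (n + 2) : ℝ) = b at *
        generalize (binomSum 2 1 (n + 1 + 2) : ℝ) = c at *
        generalize lam ^ (n + 1) = L at *
        refine le_of_mul_le_mul_left (?_ : (x + 1) * (x + 2) * (x + 3) * _ ≤
          (x + 1) * (x + 2) * (x + 3) * _) (by positivity)
        have a1 := mul_le_mul_of_nonneg_left i1 (show 0 ≤ (11 * (x + 2) ^ 2 + 11 * (x + 2) + 3) *
          (x + 1) by positivity)
        have a0 := mul_le_mul_of_nonneg_left i0 (show 0 ≤ (x + 2) ^ 3 by positivity)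
        have a2 : 0 ≤ L * (lam * (3 * x + 3) + (x + 2)) := by positivity
        linear_combination a1 + a0 + a2 - 4 * (x + 1) * (x + 2) * hrec
    cases n with
    | zero => simp [e0]
    | succ n =>
      refine (key n).trans ?_
      have : (0 : ℝ) ≤ binomSum 2 1 (n + 1) := Nat.cast_nonneg _
      push_cast
      nlinarith

theorem growthBounds_delannoy {r : ℕ} (hr : 2 ≤ r) :
    GrowthBounds (binomSum r r) ((3 + 2 * √2) ^ r) := by
  obtain ⟨s, rfl⟩ := Nat.exists_eq_add_of_le hr
  have hs := Real.sq_sqrt (show (0 : ℝ) ≤ 2 by norm_num)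
  have h0 := Real.sqrt_nonneg 2
  have hmu : (3 + 2 * √2) ^ 2 = 17 + 12 * √2 := by linear_combination 4 * hs
  have hbd := binomSum_two_two_bounds (mu := 17 + 12 * √2) (by linear_combination 144 * hs)
    (by nlinarith) (by nlinarith)
  have hsq : ∀ n, ∑ k ∈ Finset.range (n + 1), ((n.choose k * (n + k).choose k : ℕ) : ℝ) ^ 2 =
      binomSum 2 2 n := by
    intro n
    rw [binomSum]
    push_cast
    exact Finset.sum_congr rfl fun _ _ => by ring
  have hle : ∀ n, (binomSum 2 2 n : ℝ) ≤ ((3 + 2 * √2) ^ n) ^ 2 := by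
    intro n
    rw [← pow_mul, mul_comm n, pow_mul, hmu]
    refine le_trans ?_ (hbd n).1
    have h1 : (0 : ℝ) ≤ binomSum 2 2 n := Nat.cast_nonneg _
    have h2 : (0 : ℝ) ≤ n := Nat.cast_nonneg _
    nlinarith
  have h := growthBounds_sum_pow (fun n k => n.choose k * (n + k).choose k) (lam := 17 + 12 * √2)
    (mu := 3 + 2 * √2) (C := 1) (c := 1) (q := 2) 3 (by positivity) one_pos ?_ ?_ ?_ hmu.symm s (by omega)
  · have hb : binomSum (2 + s) (2 + s) = fun n => ∑ k ∈ Finset.range (n + 1),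
        (n.choose k * (n + k).choose k) ^ (2 + s) := by
      funext n; simp [binomSum, mul_pow]
    rwa [hb]
  · intro n k hk
    refine le_of_sq_le_sq ?_ (by positivity)
    refine le_trans ?_ (hle n)
    rw [← hsq n]
    exact Finset.single_le_sum (f := fun k => ((n.choose k * (n + k).choose k : ℕ) : ℝ) ^ 2)
      (fun _ _ => by positivity) hk
  · intro n
    rw [hsq, one_mul]
    exact (hbd n).1
  -- The square of the sum is at least the sum of squares, which is already bounded below.
  · intro n
    refine le_of_sq_le_sq ?_ (by positivity)
    rw [one_mul, mul_pow, ← pow_mul, mul_comm n, pow_mul, hmu]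
    refine (hbd n).2.trans ?_
    rw [← hsq n]
    have h1 := Finset.sum_sq_le_sq_sum_of_nonneg (s := Finset.range (n + 1))
      (f := fun k => ((n.choose k * (n + k).choose k : ℕ) : ℝ)) (fun _ _ => by positivity)
    gcongr
    rw [← pow_mul]
    exact pow_le_pow_right₀ (by linarith [(Nat.cast_nonneg n : (0 : ℝ) ≤ n)]) (by norm_num)

theorem growthBounds_apery {r : ℕ} (hr : 1 ≤ r) :
    GrowthBounds (binomSum (2 * r) r) (((11 + 5 * √5) / 2) ^ r) := by
  obtain ⟨s, rfl⟩ := Nat.exists_eq_add_of_le hr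
  have hs := Real.sq_sqrt (show (0 : ℝ) ≤ 5 by norm_num)
  have h0 := Real.sqrt_nonneg 5
  have hbd := binomSum_two_one_bounds (lam := (11 + 5 * √5) / 2) (by linear_combination 25 / 4 * hs)
    (by nlinarith) (by nlinarith)
  have hsum : ∀ n, ∑ k ∈ Finset.range (n + 1), ((n.choose k ^ 2 * (n + k).choose k : ℕ) : ℝ) =
      binomSum 2 1 n := by
    intro n
    simp [binomSum]
  have h := growthBounds_sum_pow (fun n k => n.choose k ^ 2 * (n + k).choose k)
    (lam := (11 + 5 * √5) / 2)
    (mu := (11 + 5 * √5) / 2) (C := 1) (c := 1 / 4) (q := 1) 1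
    (by positivity) (by norm_num) ?_ ?_ ?_ (pow_one _).symm s (by omega)
  · have hb : binomSum (2 * (1 + s)) (1 + s) = fun n => ∑ k ∈ Finset.range (n + 1),
        (n.choose k ^ 2 * (n + k).choose k) ^ (1 + s) := by
      funext n; simp [binomSum, mul_pow, pow_mul]
    rwa [hb]
  · intro n k hk
    refine le_trans ?_ (hbd n).1
    refine le_trans (b := (binomSum 2 1 n : ℝ)) ?_ ?_
    · rw [← hsum n]
      exact Finset.single_le_sum (f := fun k => ((n.choose k ^ 2 * (n + k).choose k : ℕ) : ℝ))
        (fun _ _ => by positivity) hk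
    · have h1 : (0 : ℝ) ≤ binomSum 2 1 n := Nat.cast_nonneg _
      have h2 : (0 : ℝ) ≤ n := Nat.cast_nonneg _
      nlinarith
  · intro n
    simp only [pow_one]
    rw [hsum, one_mul]
    exact (hbd n).1
  · intro n
    rw [hsum, pow_one]
    linarith [(hbd n).2]

/-! ### Distinctness of the growth rates. -/

theorem exists_nat_add_mul_sqrt_pow (a b d r : ℕ) (ha : 0 < a) (hb : 0 < b) (hr : r ≠ 0) :
    ∃ x y : ℕ, 0 < y ∧ ((a : ℝ) + b * √d) ^ r = x + y * √d := by
  obtain ⟨r, rfl⟩ := Nat.exists_eq_succ_of_ne_zero hr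
  suffices ∃ x y : ℕ, 0 < x ∧ 0 < y ∧ ((a : ℝ) + b * √d) ^ (r + 1) = x + y * √d by
    obtain ⟨x, y, -, h⟩ := this
    exact ⟨x, y, h⟩
  clear hr
  induction r with
  | zero => exact ⟨a, b, ha, hb, by simp⟩
  | succ r ih =>
    obtain ⟨x, y, hx, hy, h⟩ := ih
    refine ⟨x * a + y * b * d, x * b + y * a, by positivity, by positivity, ?_⟩
    rw [pow_succ, h]
    push_cast
    linear_combination (y * b : ℝ) * Real.sq_sqrt (Nat.cast_nonneg d : (0 : ℝ) ≤ d)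

theorem irrational_add_mul_sqrt {x y d : ℕ} (hy : 0 < y) (hd : Irrational √d) :
    Irrational ((x : ℝ) + y * √d) := by
  exact_mod_cast (hd.natCast_mul hy.ne').natCast_add x

theorem two_pow_ne_delannoy_rate {r s : ℕ} (hs : s ≠ 0) :
    (2 : ℝ) ^ r ≠ (3 + 2 * √2) ^ s := by
  obtain ⟨x, y, hy, h⟩ := exists_nat_add_mul_sqrt_pow 3 2 2 s (by norm_num) (by norm_num) hs
  push_cast at h
  rw [h]
  have := irrational_add_mul_sqrt (x := x) hy (d := 2) (by exact_mod_cast irrational_sqrt_two)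
  exact fun h0 => this ⟨2 ^ r, by push_cast at h0 ⊢; exact h0⟩

theorem two_pow_ne_apery_rate {r s : ℕ} (hs : s ≠ 0) :
    (2 : ℝ) ^ r ≠ ((11 + 5 * √5) / 2) ^ s := by
  obtain ⟨x, y, hy, h⟩ := exists_nat_add_mul_sqrt_pow 11 5 5 s (by norm_num) (by norm_num) hs
  push_cast at h
  rw [div_pow, h]
  have := irrational_add_mul_sqrt (x := x) hy (d := 5)
    (by exact_mod_cast Nat.Prime.irrational_sqrt (p := 5) (by norm_num))
  refine fun h0 => this ⟨2 ^ r * 2 ^ s, ?_⟩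
  rw [eq_div_iff (by positivity)] at h0
  push_cast at h0 ⊢; exact h0

/-- Equality would give `c√2 = d + w√5` with integers and `c, w > 0`. Squaring and irrationality of
√5 force `d = 0`, and then √10 would be rational. -/
theorem delannoy_rate_ne_apery_rate {r s : ℕ} (hr : r ≠ 0) (hs : s ≠ 0) :
    (3 + 2 * √2) ^ r ≠ ((11 + 5 * √5) / 2) ^ s := by
  obtain ⟨x, y, hy, h⟩ := exists_nat_add_mul_sqrt_pow 3 2 2 r (by norm_num) (by norm_num) hr
  obtain ⟨z, w, hw, h'⟩ := exists_nat_add_mul_sqrt_pow 11 5 5 s (by norm_num) (by norm_num) hs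
  push_cast at h h'
  rw [div_pow, h, h']
  intro h0
  rw [eq_div_iff (by positivity)] at h0
  have h2 := Real.sq_sqrt (show (0 : ℝ) ≤ 2 by norm_num)
  have h5 := Real.sq_sqrt (show (0 : ℝ) ≤ 5 by norm_num)
  have hirr5 : Irrational √5 := by
    exact_mod_cast Nat.Prime.irrational_sqrt (p := 5) (by norm_num)
  obtain ⟨d, hd⟩ : ∃ d : ℤ, d = z - x * 2 ^ s := ⟨_, rfl⟩
  obtain ⟨c, hc, hc0⟩ : ∃ c : ℕ, c = y * 2 ^ s ∧ 0 < c := ⟨_, rfl, by positivity⟩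
  have e1 : (c : ℝ) * √2 = d + w * √5 := by
    rw [hc, hd]; push_cast; linear_combination h0
  have e2 : (2 * d * w : ℝ) * √5 = 2 * c ^ 2 - d ^ 2 - 5 * w ^ 2 := by
    have := congrArg (· ^ 2) e1
    simp only [mul_pow, add_sq, h2, h5] at this
    linear_combination -this
  have hd0 : d = 0 := by
    by_contra hne
    have : Irrational (((2 * d * w : ℤ) : ℝ) * √5) :=
      hirr5.intCast_mul (by have : (w : ℤ) ≠ 0 := by exact_mod_cast hw.ne'
                            positivity)
    refine this ⟨2 * c ^ 2 - d ^ 2 - 5 * w ^ 2, ?_⟩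
    push_cast
    rw [e2]
  rw [hd0] at e2
  push_cast at e2
  have e3 : 2 * c ^ 2 = 5 * w ^ 2 := by
    have : (2 * c ^ 2 : ℝ) = 5 * w ^ 2 := by linear_combination -e2
    exact_mod_cast this
  have hirr10 : Irrational √((10 : ℕ) : ℝ) := by
    rw [irrational_sqrt_natCast_iff]
    rintro ⟨k, hk⟩
    have : k ≤ 3 := by nlinarith
    interval_cases k <;> omega
  refine hirr10 ⟨2 * c / w, ?_⟩
  have hw' : (w : ℝ) ≠ 0 := by exact_mod_cast hw.ne'
  rw [eq_comm, Real.sqrt_eq_iff_mul_self_eq (by positivity) (by positivity)]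
  push_cast
  have e4 : (2 * c ^ 2 : ℝ) = 5 * w ^ 2 := by exact_mod_cast e3
  field_simp
  linear_combination -2 * e4

/-! ### Behaviour of a power series at its radius of convergence. -/

open Filter Topology

/-- The sum of the real power series with coefficients `b`. -/
noncomputable def seriesSum (b : ℕ → ℝ) (x : ℝ) : ℝ := ∑' n, b n * x ^ n

/-- The coefficients `b n` are bounded by a polynomial in `n` times `lam ^ n`. -/
def PolyGeomBound (b : ℕ → ℝ) (lam : ℝ) : Prop :=
  ∃ (C : ℝ) (K : ℕ), 0 ≤ C ∧ ∀ n, |b n| ≤ C * ((n : ℝ) + 1) ^ K * lam ^ n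

/-- The coefficients of the derivative of a power series. -/
def derivCoeff (b : ℕ → ℝ) (n : ℕ) : ℝ := (n + 1) * b (n + 1)

theorem PolyGeomBound.derivCoeff {b : ℕ → ℝ} {lam : ℝ} (hl : 0 < lam) (h : PolyGeomBound b lam) :
    PolyGeomBound (derivCoeff b) lam := by
  obtain ⟨C, K, hC, h⟩ := h
  refine ⟨C * lam * 2 ^ K, K + 1, by positivity, fun n => ?_⟩
  have hn : (0 : ℝ) ≤ n := Nat.cast_nonneg n
  rw [_root_.derivCoeff, abs_mul, abs_of_nonneg (by positivity : (0 : ℝ) ≤ n + 1)]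
  have h1 := h (n + 1)
  push_cast at h1
  calc ((n : ℝ) + 1) * |b (n + 1)| ≤ (n + 1) * (C * (n + 1 + 1) ^ K * lam ^ (n + 1)) := by gcongr
    _ ≤ (n + 1) * (C * (2 * (n + 1)) ^ K * lam ^ (n + 1)) := by gcongr; linarith
    _ = _ := by rw [mul_pow]; ring

theorem PolyGeomBound.summable_norm {b : ℕ → ℝ} {lam : ℝ} (hl : 0 < lam) (h : PolyGeomBound b lam)
    {x : ℝ} (hx : |x| < lam⁻¹) : Summable fun n => ‖b n * x ^ n‖ := by
  obtain ⟨C, K, hC, h⟩ := h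
  have hy0 : 0 ≤ lam * |x| := by positivity
  have hy1 : lam * |x| < 1 := by
    calc lam * |x| < lam * lam⁻¹ := by gcongr
      _ = 1 := mul_inv_cancel₀ hl.ne'
  have hs : Summable fun n : ℕ => C * 2 ^ K * ((n : ℝ) ^ K * (lam * |x|) ^ n + (lam * |x|) ^ n) :=
    ((summable_pow_mul_geometric_of_norm_lt_one K (by rwa [Real.norm_of_nonneg hy0])).add
      (summable_geometric_of_lt_one hy0 hy1)).mul_left _
  refine hs.of_nonneg_of_le (fun _ => norm_nonneg _) fun n => ?_
  have hK : ((n : ℝ) + 1) ^ K ≤ 2 ^ K * ((n : ℝ) ^ K + 1) := by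
    rcases Nat.eq_zero_or_pos n with rfl | hn
    · have : (1 : ℝ) ≤ 2 ^ K := one_le_pow₀ one_le_two
      have : (0 : ℝ) ≤ 0 ^ K := by positivity
      norm_num
      nlinarith
    · have hn : (1 : ℝ) ≤ n := by exact_mod_cast hn
      calc ((n : ℝ) + 1) ^ K ≤ (2 * n) ^ K := by gcongr; linarith
        _ = 2 ^ K * (n : ℝ) ^ K := mul_pow _ _ _
        _ ≤ _ := by gcongr; linarith
  rw [norm_mul, norm_pow, Real.norm_eq_abs, Real.norm_eq_abs]
  calc |b n| * |x| ^ n ≤ (C * (2 ^ K * ((n : ℝ) ^ K + 1)) * lam ^ n) * |x| ^ n := by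
        gcongr
        exact (h n).trans (by gcongr)
    _ = _ := by rw [mul_pow]; ring

theorem PolyGeomBound.hasDerivAt {b : ℕ → ℝ} {lam : ℝ} (hl : 0 < lam) (h : PolyGeomBound b lam)
    {x : ℝ} (hx : |x| < lam⁻¹) : HasDerivAt (seriesSum b) (seriesSum (_root_.derivCoeff b) x) x := by
  obtain ⟨r, hxr, hr⟩ := exists_between hx
  have hr0 : 0 < r := (abs_nonneg x).trans_lt hxr
  have hxm : x ∈ Set.Ioo (-r) r := abs_lt.1 hxr
  have hd := h.derivCoeff hl
  have hu : Summable fun n : ℕ => |b n| * (n * r ^ (n - 1)) := by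
    rw [← summable_nat_add_iff 1]
    refine (hd.summable_norm hl (x := r) (by rwa [abs_of_pos hr0])).congr fun n => ?_
    rw [norm_mul, Real.norm_of_nonneg (pow_nonneg hr0.le n), _root_.derivCoeff, Real.norm_eq_abs,
      abs_mul, abs_of_nonneg (by positivity : (0 : ℝ) ≤ n + 1)]
    push_cast
    ring
  have hbound : ∀ (n : ℕ) (y : ℝ), y ∈ Set.Ioo (-r) r →
      ‖b n * (n * y ^ (n - 1))‖ ≤ |b n| * (n * r ^ (n - 1)) := by
    intro n y hy
    rw [norm_mul, norm_mul, norm_pow, Real.norm_natCast, Real.norm_eq_abs, Real.norm_eq_abs]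
    have := (abs_lt.2 hy).le
    gcongr
  have key := hasDerivAt_tsum_of_isPreconnected hu isOpen_Ioo isPreconnected_Ioo
    (g := fun n y => b n * y ^ n) (g' := fun n y => b n * (n * y ^ (n - 1)))
    (fun n y _ => (hasDerivAt_pow n y).const_mul (b n)) hbound hxm
    (h.summable_norm hl hx).of_norm hxm
  have hsum : Summable fun n : ℕ => b n * (n * x ^ (n - 1)) :=
    Summable.of_norm_bounded hu fun n => hbound n x hxm
  have htsum : ∑' n : ℕ, b n * (n * x ^ (n - 1)) = seriesSum (_root_.derivCoeff b) x := by
    rw [hsum.tsum_eq_zero_add, seriesSum]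
    simp only [Nat.cast_zero, zero_mul, mul_zero, zero_add, Nat.add_sub_cancel,
      _root_.derivCoeff]
    exact tsum_congr fun n => by push_cast; ring
  rw [← htsum]
  exact key

theorem PolyGeomBound.analyticAt {b : ℕ → ℝ} {lam : ℝ} (hl : 0 < lam) (h : PolyGeomBound b lam)
    {x : ℝ} (hx : |x| < lam⁻¹) : AnalyticAt ℝ (seriesSum b) x := by
  obtain ⟨r, hxr, hr⟩ := exists_between hx
  have hr0 : 0 < r := (abs_nonneg x).trans_lt hxr
  have hs := h.summable_norm hl (x := r) (by rwa [abs_of_pos hr0])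
  let p := FormalMultilinearSeries.ofScalars ℝ b
  have hrad : (r.toNNReal : ENNReal) ≤ p.radius := by
    refine p.le_radius_of_bound (∑' n, ‖b n * r ^ n‖) fun n => ?_
    rw [Real.coe_toNNReal r hr0.le]
    refine le_trans (le_of_eq ?_) (hs.le_tsum n fun _ _ => norm_nonneg _)
    rw [FormalMultilinearSeries.ofScalars_norm, norm_mul, Real.norm_of_nonneg (pow_nonneg hr0.le n)]
  have hpos : 0 < p.radius := lt_of_lt_of_le (by simpa using hr0) hrad
  have hball := p.hasFPowerSeriesOnBall hpos
  have hfun : p.sum = seriesSum b := by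
    funext y
    change FormalMultilinearSeries.ofScalarsSum b y = _
    rw [FormalMultilinearSeries.ofScalarsSum_eq_tsum]
    simp [seriesSum]
  rw [← hfun]
  apply hball.analyticAt_of_mem
  rw [Metric.mem_eball, edist_dist, dist_zero_right, Real.norm_eq_abs]
  refine lt_of_lt_of_le ?_ hrad
  rwa [ENNReal.ofReal, ENNReal.coe_lt_coe, Real.toNNReal_lt_toNNReal_iff hr0]

theorem seriesSum_ge_term {b : ℕ → ℝ} {lam : ℝ} (hl : 0 < lam) (h : PolyGeomBound b lam)
    (hb : ∀ n, 0 ≤ b n) {x : ℝ} (hx0 : 0 ≤ x) (hx : x < lam⁻¹) (n : ℕ) :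
    b n * x ^ n ≤ seriesSum b x :=
  (h.summable_norm hl (by rwa [abs_of_nonneg hx0])).of_norm.le_tsum n
    fun m _ => mul_nonneg (hb m) (pow_nonneg hx0 m)

theorem eventually_left_of_pos {r : ℝ} (hr : 0 < r) : ∀ᶠ x in 𝓝[<] r, 0 < x ∧ x < r :=
  Ioo_mem_nhdsLT hr

/-- If a power series with nonnegative coefficients extends analytically to the real point of its
circle of convergence, its coefficients decrease rapidly relative to that circle. -/
theorem exists_bound_of_analytic_extension (K : ℕ) {lam : ℝ} (hl : 0 < lam) :
    ∀ (b : ℕ → ℝ) (h : ℝ → ℝ), PolyGeomBound b lam → (∀ n, 0 ≤ b n) → AnalyticAt ℝ h lam⁻¹ →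
      (∀ᶠ x in 𝓝[<] lam⁻¹, seriesSum b x = h x) →
      ∃ M : ℝ, ∀ n : ℕ, (n.descFactorial K : ℝ) * b n ≤ M * lam ^ n := by
  have hr : 0 < lam⁻¹ := inv_pos.2 hl
  induction K with
  | zero =>
    intro b h hb hb0 hh heq
    refine ⟨h lam⁻¹, fun n => ?_⟩
    have h1 : Tendsto (fun x : ℝ => b n * x ^ n) (𝓝[<] lam⁻¹) (𝓝 (b n * lam⁻¹ ^ n)) :=
      ((continuous_const.mul (continuous_pow n)).tendsto _).mono_left nhdsWithin_le_nhds
    have h2 : Tendsto h (𝓝[<] lam⁻¹) (𝓝 (h lam⁻¹)) :=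
      hh.continuousAt.tendsto.mono_left nhdsWithin_le_nhds
    have h3 : b n * lam⁻¹ ^ n ≤ h lam⁻¹ := by
      refine le_of_tendsto_of_tendsto h1 h2 ?_
      filter_upwards [heq, eventually_left_of_pos hr] with x hx1 hx2
      rw [← hx1]
      exact seriesSum_ge_term hl hb hb0 hx2.1.le hx2.2 n
    rw [Nat.descFactorial_zero, Nat.cast_one, one_mul]
    calc b n = b n * lam⁻¹ ^ n * lam ^ n := by
          rw [mul_assoc, ← mul_pow, inv_mul_cancel₀ hl.ne', one_pow, mul_one]
      _ ≤ _ := by gcongr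
  | succ K ih =>
    intro b h hb hb0 hh heq
    -- The derivative again has nonnegative coefficients and an analytic extension, and each
    -- differentiation gains a factor of order `n`.
    obtain ⟨M, hM⟩ := ih (derivCoeff b) (deriv h) (hb.derivCoeff hl)
      (fun n => mul_nonneg (by positivity) (hb0 _)) hh.deriv (by
        obtain ⟨a, ha, hS⟩ := (mem_nhdsLT_iff_exists_Ioo_subset).1 heq
        filter_upwards [Ioo_mem_nhdsLT (max_lt ha hr)] with x hx
        have hxm : x ∈ Set.Ioo a lam⁻¹ := ⟨(le_max_left _ _).trans_lt hx.1, hx.2⟩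
        have hx0 : 0 < x := (le_max_right _ _).trans_lt hx.1
        have hev : seriesSum b =ᶠ[𝓝 x] h := by
          filter_upwards [Ioo_mem_nhds hxm.1 hxm.2] with y hy using hS hy
        rw [← hev.deriv_eq, (hb.hasDerivAt hl (by rw [abs_of_pos hx0]; exact hx.2)).deriv])
    refine ⟨M / lam, fun n => ?_⟩
    cases n with
    | zero =>
      have := hM 0
      have hM0 : 0 ≤ M := by
        refine le_trans ?_ (this.trans (by simp))
        exact mul_nonneg (by positivity) (mul_nonneg (by positivity) (hb0 _))
      simp only [Nat.zero_descFactorial_succ, Nat.cast_zero, zero_mul, pow_zero, mul_one]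
      positivity
    | succ n =>
      have := hM n
      rw [derivCoeff] at this
      rw [Nat.succ_descFactorial_succ, pow_succ]
      push_cast
      calc ((n : ℝ) + 1) * (n.descFactorial K) * b (n + 1)
          = (n.descFactorial K) * ((n + 1) * b (n + 1)) := by ring
        _ ≤ M * lam ^ n := this
        _ = _ := by field_simp

theorem GrowthBounds.polyGeomBound {b : ℕ → ℕ} {lam : ℝ} (h : GrowthBounds b lam) :
    PolyGeomBound (fun n => (b n : ℝ)) lam := by
  obtain ⟨⟨C, hC⟩, -⟩ := h
  have hle : ∀ n, (b n : ℝ) ≤ C * lam ^ n := fun n => by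
    refine le_trans ?_ (hC n)
    have h1 : (0 : ℝ) ≤ b n := Nat.cast_nonneg _
    have h2 : (0 : ℝ) ≤ n := Nat.cast_nonneg _
    nlinarith
  refine ⟨C, 0, ?_, fun n => ?_⟩
  · have := hle 0
    rw [pow_zero, mul_one] at this
    exact (Nat.cast_nonneg _).trans this
  · rw [pow_zero, mul_one, abs_of_nonneg (Nat.cast_nonneg _)]
    exact hle n

/-- A power series with `GrowthBounds` has no analytic extension at its radius of convergence. -/
theorem GrowthBounds.not_analytic_extension {b : ℕ → ℕ} {lam : ℝ} (hl : 0 < lam)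
    (hG : GrowthBounds b lam) (h : ℝ → ℝ) (hh : AnalyticAt ℝ h lam⁻¹)
    (heq : ∀ᶠ x in 𝓝[<] lam⁻¹, seriesSum (fun n => (b n : ℝ)) x = h x) : False := by
  obtain ⟨c, hc, K, hlow⟩ := hG.2
  -- One derivative more than the exponent `K` of the lower bound makes `m * c` bounded in `m`, a
  -- contradiction.
  obtain ⟨M, hM⟩ := exists_bound_of_analytic_extension (K + 1) hl _ h (hG.polyGeomBound)
    (fun n => Nat.cast_nonneg _) hh heq
  have key : ∀ m : ℕ, K + 1 ≤ m → (m : ℝ) * c ≤ 2 ^ K * M := by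
    intro m hm
    have h1 := hM (m + K)
    have h2 := hlow (m + K)
    have h3 : ((m : ℝ)) ^ (K + 1) ≤ ((m + K).descFactorial (K + 1) : ℕ) := by
      have := Nat.pow_sub_le_descFactorial (m + K) (K + 1)
      rw [show m + K + 1 - (K + 1) = m by omega] at this
      exact_mod_cast this
    have hL : 0 < lam ^ (m + K) := by positivity
    have hm0 : (0 : ℝ) < m := by exact_mod_cast (by omega : 0 < m)
    have hmK : ((m + K : ℕ) : ℝ) + 1 ≤ 2 * m := by exact_mod_cast (by omega : m + K + 1 ≤ 2 * m)
    have h4 : (m : ℝ) ^ (K + 1) * (c * lam ^ (m + K)) ≤ (2 * m) ^ K * (M * lam ^ (m + K)) := by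
      calc (m : ℝ) ^ (K + 1) * (c * lam ^ (m + K))
          ≤ (m : ℝ) ^ (K + 1) * ((((m + K : ℕ) : ℝ) + 1) ^ K * b (m + K)) := by gcongr
        _ ≤ ((m + K).descFactorial (K + 1) : ℕ) * ((2 * m) ^ K * b (m + K)) := by gcongr
        _ = (2 * m) ^ K * (((m + K).descFactorial (K + 1) : ℕ) * b (m + K)) := by ring
        _ ≤ _ := by gcongr
    have h5 : 0 < (m : ℝ) ^ K * lam ^ (m + K) := by positivity
    refine le_of_mul_le_mul_left (?_ : (m : ℝ) ^ K * lam ^ (m + K) * _ ≤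
      (m : ℝ) ^ K * lam ^ (m + K) * _) h5
    rw [mul_pow] at h4
    linear_combination h4
  obtain ⟨m, hm⟩ := exists_nat_gt (max (2 ^ K * M / c) (K + 1))
  have hm1 : K + 1 ≤ m := by exact_mod_cast ((le_max_right _ _).trans_lt hm).le
  have hm2 := (le_max_left _ _).trans_lt hm
  rw [div_lt_iff₀ hc] at hm2
  linarith [key m hm1]

/-- Termwise comparison with the series of `-log (1 - lam * x)`. -/
theorem GrowthBounds.seriesSum_le_log {b : ℕ → ℕ} {lam : ℝ} (hl : 0 < lam)
    (hG : GrowthBounds b lam) : ∃ B C : ℝ, 0 ≤ B ∧ 0 ≤ C ∧ ∀ x, 0 < x → x < lam⁻¹ →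
      seriesSum (fun n => (b n : ℝ)) x ≤ B + C * -Real.log (1 - lam * x) := by
  have hpg := hG.polyGeomBound
  obtain ⟨⟨C, hC⟩, -⟩ := hG
  have hC0 : 0 ≤ C := by
    have := hC 0
    rw [pow_zero, mul_one, Nat.cast_zero, zero_add, mul_one] at this
    exact (Nat.cast_nonneg _).trans this
  refine ⟨b 0, C, Nat.cast_nonneg _, hC0, fun x hx0 hx => ?_⟩
  have hy1 : lam * x < 1 := by
    calc lam * x < lam * lam⁻¹ := by gcongr
      _ = 1 := mul_inv_cancel₀ hl.ne'
  have hy0 : 0 < lam * x := by positivity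
  have hs := (hpg.summable_norm hl (by rwa [abs_of_pos hx0])).of_norm
  have hlog := (Real.hasSum_pow_div_log_of_abs_lt_one (x := lam * x)
    (by rwa [abs_of_pos hy0])).mul_left C
  rw [seriesSum, hs.tsum_eq_zero_add, pow_zero, mul_one]
  gcongr
  refine hasSum_le (fun n => ?_) ((summable_nat_add_iff 1).2 hs).hasSum hlog
  have h1 := hC (n + 1)
  push_cast at h1
  have hn : (0 : ℝ) ≤ n := Nat.cast_nonneg n
  have h2 : (b (n + 1) : ℝ) * (n + 1) ≤ C * lam ^ (n + 1) := by
    refine le_trans ?_ h1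
    gcongr; linarith
  rw [mul_pow, ← mul_div_assoc, le_div_iff₀ (by positivity)]
  calc (b (n + 1) : ℝ) * x ^ (n + 1) * (n + 1) = b (n + 1) * (n + 1) * x ^ (n + 1) := by ring
    _ ≤ C * lam ^ (n + 1) * x ^ (n + 1) := by gcongr
    _ = _ := by ring

theorem tendsto_mul_log_pow (B C : ℝ) (a : ℕ) :
    Tendsto (fun u : ℝ => u * (B + C * -Real.log u) ^ a) (𝓝[>] 0) (𝓝 0) := by
  have h1 : Tendsto (fun y : ℝ => (B + C * Real.log y) ^ a / y) atTop (𝓝 0) := by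
    have hO : (fun y : ℝ => (B + C * Real.log y) ^ a) =O[atTop] fun y => Real.log y ^ a := by
      refine Asymptotics.IsBigO.pow ?_ a
      exact (Real.isLittleO_const_log_atTop.isBigO).add (Asymptotics.isBigO_const_mul_self C _ _)
    exact (hO.trans_isLittleO Real.isLittleO_pow_log_id_atTop).tendsto_div_nhds_zero
  have h2 := h1.comp tendsto_inv_nhdsGT_zero
  refine h2.congr fun u => ?_
  simp only [Function.comp, Real.log_inv, div_inv_eq_mul]
  ring

theorem GrowthBounds.tendsto_sub_mul_pow {b : ℕ → ℕ} {lam : ℝ} (hl : 0 < lam)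
    (hG : GrowthBounds b lam) (a : ℕ) :
    Tendsto (fun x => (x - lam⁻¹) * seriesSum (fun n => (b n : ℝ)) x ^ a) (𝓝[<] lam⁻¹) (𝓝 0) := by
  have hr : 0 < lam⁻¹ := inv_pos.2 hl
  obtain ⟨B, C, hB, hC, hle⟩ := hG.seriesSum_le_log hl
  have hu : Tendsto (fun x => 1 - lam * x) (𝓝[<] lam⁻¹) (𝓝[>] 0) := by
    refine tendsto_nhdsWithin_iff.2 ⟨?_, ?_⟩
    · have : Tendsto (fun x => 1 - lam * x) (𝓝 lam⁻¹) (𝓝 (1 - lam * lam⁻¹)) :=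
        (by fun_prop : Continuous fun x => 1 - lam * x).tendsto _
      rw [mul_inv_cancel₀ hl.ne', sub_self] at this
      exact this.mono_left nhdsWithin_le_nhds
    · filter_upwards [eventually_left_of_pos hr] with x hx
      have : lam * x < lam * lam⁻¹ := by gcongr; exact hx.2
      rw [mul_inv_cancel₀ hl.ne'] at this
      exact sub_pos.2 this
  have h1 := ((tendsto_mul_log_pow B C a).comp hu).const_mul lam⁻¹
  rw [mul_zero] at h1
  refine squeeze_zero_norm' ?_ h1
  filter_upwards [eventually_left_of_pos hr] with x hx
  have h0 : 0 ≤ seriesSum (fun n => (b n : ℝ)) x :=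
    tsum_nonneg fun n => mul_nonneg (Nat.cast_nonneg _) (pow_nonneg hx.1.le n)
  rw [norm_mul, norm_pow, Real.norm_of_nonneg h0, Real.norm_of_nonpos (by linarith [hx.2])]
  have h2 : -(x - lam⁻¹) = lam⁻¹ * (1 - lam * x) := by field_simp; ring
  rw [h2, mul_assoc]
  have h3 : 0 ≤ 1 - lam * x := by
    have : lam * x < lam * lam⁻¹ := by gcongr; exact hx.2
    rw [mul_inv_cancel₀ hl.ne'] at this
    linarith
  simp only [Function.comp]
  gcongr
  exact hle x hx.1 hx.2

theorem exists_eq_pow_mul_eval_ne_zero {P : Polynomial ℝ} (hP : P ≠ 0) (r : ℝ) :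
    ∃ (m : ℕ) (Q : Polynomial ℝ), Q.eval r ≠ 0 ∧ ∀ x, P.eval x = (x - r) ^ m * Q.eval x := by
  obtain ⟨Q, hQ, hd⟩ := P.exists_eq_pow_rootMultiplicity_mul_and_not_dvd hP r
  refine ⟨P.rootMultiplicity r, Q, fun h => hd (Polynomial.dvd_iff_isRoot.2 h), fun x => ?_⟩
  nth_rewrite 1 [hQ]
  simp

/-- A power of a series with `GrowthBounds` is not meromorphic at the radius of convergence. -/
theorem GrowthBounds.not_meromorphic {b : ℕ → ℕ} {lam : ℝ} (hl : 0 < lam) (hb0 : b 0 = 1)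
    (hG : GrowthBounds b lam) {a : ℕ} (ha : a ≠ 0) {U V : ℝ → ℝ} (hU : AnalyticAt ℝ U lam⁻¹)
    (hV : AnalyticAt ℝ V lam⁻¹) (hU0 : U lam⁻¹ ≠ 0) (hV0 : V lam⁻¹ ≠ 0) {P Q : Polynomial ℝ}
    (hP : P ≠ 0) (hQ : Q ≠ 0)
    (h : ∀ᶠ x in 𝓝[<] lam⁻¹,
      P.eval x * seriesSum (fun n => (b n : ℝ)) x ^ a * U x = Q.eval x * V x) : False := by
  have hr : 0 < lam⁻¹ := inv_pos.2 hl
  have hleft := eventually_left_of_pos hr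
  set r := lam⁻¹ with hrdef
  set F := seriesSum (fun n => (b n : ℝ)) with hF
  have hF1 : ∀ᶠ x in 𝓝[<] r, 1 ≤ F x := by
    filter_upwards [hleft] with x hx
    have := seriesSum_ge_term hl (hG.polyGeomBound) (fun n => Nat.cast_nonneg _) hx.1.le hx.2 0
    simpa [hb0] using this
  obtain ⟨m, P₁, hP₁, hPe⟩ := exists_eq_pow_mul_eval_ne_zero hP r
  obtain ⟨n, Q₁, hQ₁, hQe⟩ := exists_eq_pow_mul_eval_ne_zero hQ r
  have hPa : AnalyticAt ℝ (fun x => P₁.eval x * U x) r :=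
    (AnalyticOnNhd.eval_polynomial P₁ r (Set.mem_univ _)).mul hU
  have hQa : AnalyticAt ℝ (fun x => Q₁.eval x * V x) r :=
    (AnalyticOnNhd.eval_polynomial Q₁ r (Set.mem_univ _)).mul hV
  have hPn : P₁.eval r * U r ≠ 0 := mul_ne_zero hP₁ hU0
  have hQn : Q₁.eval r * V r ≠ 0 := mul_ne_zero hQ₁ hV0
  set A := fun x => P₁.eval x * U x with hA
  set B := fun x => Q₁.eval x * V x with hB
  have hAt : Tendsto A (𝓝[<] r) (𝓝 (A r)) := hPa.continuousAt.tendsto.mono_left nhdsWithin_le_nhds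
  have hBt : Tendsto B (𝓝[<] r) (𝓝 (B r)) := hQa.continuousAt.tendsto.mono_left nhdsWithin_le_nhds
  have hsub : Tendsto (fun x => x - r) (𝓝[<] r) (𝓝 0) := by
    have : Tendsto (fun x => x - r) (𝓝 r) (𝓝 (r - r)) := (continuous_sub_right r).tendsto _
    rw [sub_self] at this
    exact this.mono_left nhdsWithin_le_nhds
  have hmain : ∀ᶠ x in 𝓝[<] r, (x - r) ^ m * (F x ^ a * A x) = (x - r) ^ n * B x := by
    filter_upwards [h] with x hx
    rw [hPe, hQe] at hx
    simp only [hA, hB]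
    linear_combination hx
  -- Compare the orders of vanishing of `P` and `Q`. If `m < n`, then `F ≥ 1` forces `A` to tend to
  -- 0; if `m > n`, logarithmic growth forces `B` to tend to 0.
  rcases lt_trichotomy m n with hmn | rfl | hmn
  · obtain ⟨d, rfl⟩ := Nat.exists_eq_add_of_lt hmn
    have hlim : Tendsto (fun x => (x - r) ^ (d + 1) * B x) (𝓝[<] r) (𝓝 0) := by
      have := (hsub.pow (d + 1)).mul hBt
      rwa [zero_pow (Nat.succ_ne_zero d), zero_mul] at this
    have hA0 : Tendsto A (𝓝[<] r) (𝓝 0) := by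
      refine squeeze_zero_norm' ?_ (tendsto_zero_iff_norm_tendsto_zero.1 hlim)
      filter_upwards [hmain, hF1, hleft] with x hx h1 hx0
      have hne : (x - r) ^ m ≠ 0 := pow_ne_zero _ (sub_ne_zero.2 hx0.2.ne)
      rw [show m + d + 1 = m + (d + 1) by ring, pow_add, mul_assoc] at hx
      rw [← mul_left_cancel₀ hne hx, norm_mul (F x ^ a), norm_pow]
      have : 1 ≤ ‖F x‖ ^ a := one_le_pow₀ (h1.trans (le_abs_self _))
      nlinarith [norm_nonneg (A x)]
    exact hPn (tendsto_nhds_unique hAt hA0)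
  · have hW : AnalyticAt ℝ (fun x => B x / A x) r := hQa.div hPa hPn
    have hFW : ∀ᶠ x in 𝓝[<] r, F x ^ a = B x / A x := by
      filter_upwards [hmain, hleft, hAt.eventually_ne hPn] with x hx hx0 hAx
      have hne : (x - r) ^ m ≠ 0 := pow_ne_zero _ (sub_ne_zero.2 hx0.2.ne)
      rw [eq_div_iff hAx]
      exact mul_left_cancel₀ hne hx
    have hWr : B r / A r ≠ 0 := div_ne_zero hQn hPn
    -- With equal orders `F ^ a` is analytic and nonzero at `r`; since `F ≥ 1`, the real `a`-th root
    -- recovers `F`.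
    have hroot : AnalyticAt ℝ (fun x => (B x / A x) ^ (1 / (a : ℝ))) r :=
      (hW.contDiffAt.rpow_const_of_ne hWr).analyticAt
    refine hG.not_analytic_extension hl _ hroot ?_
    filter_upwards [hFW, hF1] with x hx h1
    rw [← hx, one_div, Real.pow_rpow_inv_natCast (by linarith) ha]
  · obtain ⟨d, rfl⟩ := Nat.exists_eq_add_of_lt hmn
    have hlim : Tendsto (fun x => (x - r) ^ d * ((x - r) * F x ^ a) * A x) (𝓝[<] r) (𝓝 0) := by
      have := ((hsub.pow d).mul (hG.tendsto_sub_mul_pow hl a)).mul hAt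
      rwa [mul_zero, zero_mul] at this
    have hB0 : Tendsto B (𝓝[<] r) (𝓝 0) := by
      refine hlim.congr' ?_
      filter_upwards [hmain, hleft] with x hx hx0
      have hne : (x - r) ^ n ≠ 0 := pow_ne_zero _ (sub_ne_zero.2 hx0.2.ne)
      refine mul_left_cancel₀ hne ?_
      rw [← hx]; ring
    exact hQn (tendsto_nhds_unique hBt hB0)

/-! ### From identities of formal series to identities of functions. -/

open PowerSeries in
theorem summable_and_seriesSum_mul {x : ℝ} {g h : ℝ⟦X⟧}
    (hg : Summable fun n => ‖coeff n g * x ^ n‖) (hh : Summable fun n => ‖coeff n h * x ^ n‖) :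
    (Summable fun n => ‖coeff n (g * h) * x ^ n‖) ∧
      seriesSum (fun n => coeff n (g * h)) x =
        seriesSum (fun n => coeff n g) x * seriesSum (fun n => coeff n h) x := by
  have key : ∀ n, coeff n (g * h) * x ^ n = ∑ kl ∈ Finset.HasAntidiagonal.antidiagonal n,
      (coeff kl.1 g * x ^ kl.1) * (coeff kl.2 h * x ^ kl.2) := by
    intro n
    rw [coeff_mul, Finset.sum_mul]
    refine Finset.sum_congr rfl fun kl hkl => ?_
    rw [← Finset.HasAntidiagonal.mem_antidiagonal.1 hkl, pow_add]
    ring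
  refine ⟨?_, ?_⟩
  · simp only [key]
    exact summable_norm_sum_mul_antidiagonal_of_summable_norm
      (f := fun n => coeff n g * x ^ n) (g := fun n => coeff n h * x ^ n) hg hh
  · simp only [seriesSum, key]
    exact (tsum_mul_tsum_eq_tsum_sum_antidiagonal_of_summable_norm
      (f := fun n => coeff n g * x ^ n) (g := fun n => coeff n h * x ^ n) hg hh).symm

theorem seriesSum_polynomial (P : Polynomial ℝ) (x : ℝ) :
    (Summable fun n => ‖PowerSeries.coeff n (P : PowerSeries ℝ) * x ^ n‖) ∧
      seriesSum (fun n => PowerSeries.coeff n (P : PowerSeries ℝ)) x = P.eval x := by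
  have h0 : ∀ n ∉ Finset.range (P.natDegree + 1),
      PowerSeries.coeff n (P : PowerSeries ℝ) * x ^ n = 0 := by
    intro n hn
    rw [Polynomial.coeff_coe, Polynomial.coeff_eq_zero_of_natDegree_lt
      (by simpa [Nat.lt_succ_iff] using hn), zero_mul]
  refine ⟨summable_of_ne_finset_zero (s := Finset.range (P.natDegree + 1))
    fun n hn => by rw [h0 n hn, norm_zero], ?_⟩
  rw [seriesSum, tsum_eq_sum h0, Polynomial.eval_eq_sum_range]
  simp

open PowerSeries in
theorem seriesSum_pow {x : ℝ} {g : ℝ⟦X⟧} (hg : Summable fun n => ‖coeff n g * x ^ n‖) (k : ℕ) :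
    (Summable fun n => ‖coeff n (g ^ k) * x ^ n‖) ∧
      seriesSum (fun n => coeff n (g ^ k)) x = seriesSum (fun n => coeff n g) x ^ k := by
  induction k with
  | zero => simpa using seriesSum_polynomial 1 x
  | succ k ih =>
    rw [pow_succ, pow_succ, ← ih.2]
    exact summable_and_seriesSum_mul ih.1 hg

open PowerSeries in
theorem seriesSum_seriesMonomial {ι : Type*} {x : ℝ} (g : ι → ℝ⟦X⟧) (m : ι →₀ ℕ)
    (hg : ∀ j ∈ m.support, Summable fun n => ‖coeff n (g j) * x ^ n‖) :
    (Summable fun n => ‖coeff n (seriesMonomial g m) * x ^ n‖) ∧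
      seriesSum (fun n => coeff n (seriesMonomial g m)) x =
        ∏ j ∈ m.support, seriesSum (fun n => coeff n (g j)) x ^ m j := by
  classical
  simp only [seriesMonomial, Finsupp.prod]
  revert hg
  generalize m.support = s
  intro hg
  induction s using Finset.induction_on with
  | empty => simpa using seriesSum_polynomial 1 x
  | insert j s hj ih =>
    have ih := ih fun i hi => hg i (Finset.mem_insert_of_mem hi)
    have hpow := seriesSum_pow (hg j (Finset.mem_insert_self j s)) (m j)
    rw [Finset.prod_insert hj, Finset.prod_insert hj, ← ih.2, ← hpow.2]
    exact summable_and_seriesSum_mul hpow.1 ih.1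

theorem seriesMonomial_add {ι R : Type*} [CommSemiring R] (f : ι → PowerSeries R) (k l : ι →₀ ℕ) :
    seriesMonomial f (k + l) = seriesMonomial f k * seriesMonomial f l :=
  Finsupp.prod_add_index' (fun _ => pow_zero _) fun _ _ _ => pow_add _ _ _

/-! ### Multiplicative independence modulo rational functions. -/

section

variable {ι : Type*} {b : ι → ℕ → ℕ} {lam : ι → ℝ}

/-- The real power series with coefficients `b n`. -/
noncomputable def realSeries (b : ℕ → ℕ) : PowerSeries ℝ := PowerSeries.mk fun n => (b n : ℝ)

theorem analyticAt_prod_seriesSum (hl : ∀ i, 0 < lam i) (hb : ∀ i, b i 0 = 1)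
    (hG : ∀ i, GrowthBounds (b i) (lam i)) (i : ι) (m : ι →₀ ℕ)
    (hm : ∀ j ∈ m.support, lam j < lam i) :
    AnalyticAt ℝ (fun x => ∏ j ∈ m.support, seriesSum (fun n => (b j n : ℝ)) x ^ m j) (lam i)⁻¹ ∧
      ∏ j ∈ m.support, seriesSum (fun n => (b j n : ℝ)) (lam i)⁻¹ ^ m j ≠ 0 := by
  have hr : 0 < (lam i)⁻¹ := inv_pos.2 (hl i)
  have hlt : ∀ j ∈ m.support, (lam i)⁻¹ < (lam j)⁻¹ := fun j hj =>
    (inv_lt_inv₀ (hl i) (hl j)).2 (hm j hj)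
  constructor
  · refine Finset.analyticAt_fun_prod _ fun j hj => AnalyticAt.pow ?_ _
    exact (hG j).polyGeomBound.analyticAt (hl j) (by rw [abs_of_pos hr]; exact hlt j hj)
  · refine Finset.prod_ne_zero_iff.2 fun j hj => pow_ne_zero _ (ne_of_gt ?_)
    have := seriesSum_ge_term (hl j) (hG j).polyGeomBound (fun n => Nat.cast_nonneg _) hr.le
      (hlt j hj) 0
    rw [hb j, pow_zero, mul_one, Nat.cast_one] at this
    linarith

/-- Every other series involved has a larger radius, so near `(lam i)⁻¹` its powers are analytic and
nonzero; what remains is a power of series `i`, to which `GrowthBounds.not_meromorphic` applies. -/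
theorem no_dominated_relation (hl : ∀ i, 0 < lam i) (hb : ∀ i, b i 0 = 1)
    (hG : ∀ i, GrowthBounds (b i) (lam i)) (i : ι) (s t : ι →₀ ℕ) (hi : s i ≠ 0)
    (hs : ∀ j ∈ s.support, j ≠ i → lam j < lam i) (ht : ∀ j ∈ t.support, lam j < lam i)
    {P Q : Polynomial ℝ} (hP : P ≠ 0) (hQ : Q ≠ 0)
    (h : (P : PowerSeries ℝ) * seriesMonomial (fun i => realSeries (b i)) s =
      Q * seriesMonomial (fun i => realSeries (b i)) t) : False := by
  classical
  have hs' : ∀ j ∈ (s.erase i).support, lam j < lam i := by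
    intro j hj
    rw [Finsupp.support_erase, Finset.mem_erase] at hj
    exact hs j hj.2 hj.1
  obtain ⟨hU, hU0⟩ := analyticAt_prod_seriesSum hl hb hG i (s.erase i) hs'
  obtain ⟨hV, hV0⟩ := analyticAt_prod_seriesSum hl hb hG i t ht
  refine (hG i).not_meromorphic (hl i) (hb i) hi hU hV hU0 hV0 hP hQ ?_
  filter_upwards [eventually_left_of_pos (inv_pos.2 (hl i))] with x hx
  have hsum : ∀ j, lam j ≤ lam i →
      Summable fun n => ‖PowerSeries.coeff n (realSeries (b j)) * x ^ n‖ := by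
    intro j hj
    simp only [realSeries, PowerSeries.coeff_mk]
    refine (hG j).polyGeomBound.summable_norm (hl j) ?_
    rw [abs_of_pos hx.1]
    exact hx.2.trans_le (inv_anti₀ (hl j) hj)
  have hcoe : ∀ j, (fun n => PowerSeries.coeff n (realSeries (b j))) = fun n => (b j n : ℝ) :=
    fun j => by funext n; simp [realSeries]
  have e1 := seriesSum_seriesMonomial (x := x) (fun i => realSeries (b i)) (s.erase i)
    fun j hj => hsum j (hs' j hj).le
  have e2 := seriesSum_seriesMonomial (x := x) (fun i => realSeries (b i)) t
    fun j hj => hsum j (ht j hj).le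
  have e3 := seriesSum_pow (hsum i le_rfl) (s i)
  have e4 := summable_and_seriesSum_mul e3.1 e1.1
  have e5 := summable_and_seriesSum_mul (seriesSum_polynomial P x).1 e4.1
  have e6 := summable_and_seriesSum_mul (seriesSum_polynomial Q x).1 e2.1
  have hsplit : seriesMonomial (fun i => realSeries (b i)) s = realSeries (b i) ^ s i *
      seriesMonomial (fun i => realSeries (b i)) (s.erase i) :=
    (Finsupp.mul_prod_erase s i (fun j k => realSeries (b j) ^ k)
      (Finsupp.mem_support_iff.2 hi)).symm
  rw [hsplit] at h
  have e7 := e5.2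
  rw [h, e6.2, e4.2, e3.2, e1.2, e2.2, (seriesSum_polynomial P x).2,
    (seriesSum_polynomial Q x).2] at e7
  simp only [hcoe] at e7
  rw [mul_assoc]
  exact e7.symm

/-- Power series with distinct radii of convergence and `GrowthBounds` are multiplicatively
independent modulo rational functions. -/
theorem no_proportional_monomials (hl : ∀ i, 0 < lam i) (hinj : Function.Injective lam)
    (hb : ∀ i, b i 0 = 1) (hG : ∀ i, GrowthBounds (b i) (lam i)) (k l : ι →₀ ℕ) (hkl : k ≠ l)
    {P Q : Polynomial ℝ} (hPQ : P ≠ 0 ∨ Q ≠ 0)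
    (h : (P : PowerSeries ℝ) * seriesMonomial (fun i => realSeries (b i)) k =
      Q * seriesMonomial (fun i => realSeries (b i)) l) : False := by
  classical
  set g := fun i => realSeries (b i) with hg
  have hg0 : ∀ m : ι →₀ ℕ, seriesMonomial g m ≠ 0 := by
    intro m
    refine Finset.prod_ne_zero_iff.2 fun j _ => pow_ne_zero _ fun h0 => ?_
    have := congrArg (PowerSeries.coeff 0) h0
    simp [hg, realSeries, hb] at this
  have hP : P ≠ 0 := by
    rintro rfl
    rw [Polynomial.coe_zero, zero_mul, eq_comm] at h
    have h1 := (mul_eq_zero.1 h).resolve_right (hg0 l)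
    exact hPQ.elim (fun h => h rfl) fun h => h (by exact_mod_cast h1)
  have hQ : Q ≠ 0 := by
    rintro rfl
    rw [Polynomial.coe_zero, zero_mul] at h
    have h1 := (mul_eq_zero.1 h).resolve_right (hg0 k)
    exact hP (by exact_mod_cast h1)
  -- Cancelling the common part leaves monomials with disjoint supports, so the variable of largest
  -- rate occurs on one side only.
  have hk : k = (k - l) + k ⊓ l := by ext i; simp only [Finsupp.add_apply, Finsupp.tsub_apply, Finsupp.inf_apply]; omega
  have hl' : l = (l - k) + k ⊓ l := by ext i; simp only [Finsupp.add_apply, Finsupp.tsub_apply, Finsupp.inf_apply]; omega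
  have h' : (P : PowerSeries ℝ) * seriesMonomial g (k - l) = Q * seriesMonomial g (l - k) := by
    have ek : seriesMonomial g k = seriesMonomial g (k - l) * seriesMonomial g (k ⊓ l) := by
      rw [← seriesMonomial_add, ← hk]
    have el : seriesMonomial g l = seriesMonomial g (l - k) * seriesMonomial g (k ⊓ l) := by
      rw [← seriesMonomial_add, ← hl']
    rw [ek, el, ← mul_assoc, ← mul_assoc] at h
    exact mul_right_cancel₀ (hg0 _) h
  have hne : ((k - l).support ∪ (l - k).support).Nonempty := by
    obtain ⟨i, hi⟩ := Finsupp.ne_iff.1 hkl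
    refine ⟨i, ?_⟩
    simp only [Finset.mem_union, Finsupp.mem_support_iff, Finsupp.tsub_apply]
    omega
  obtain ⟨i, hi, hmax⟩ := Finset.exists_max_image _ lam hne
  have hlt : ∀ j, j ∈ (k - l).support ∪ (l - k).support → j ≠ i → lam j < lam i :=
    fun j hj hji => lt_of_le_of_ne (hmax j hj) (hinj.ne hji)
  have hdisj : ∀ j, j ∈ (k - l).support → j ∉ (l - k).support := by
    intro j
    simp only [Finsupp.mem_support_iff, Finsupp.tsub_apply]
    omega
  rcases Finset.mem_union.1 hi with hik | hil
  · exact no_dominated_relation hl hb hG i (k - l) (l - k) (Finsupp.mem_support_iff.1 hik)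
      (fun j hj => hlt j (Finset.mem_union_left _ hj))
      (fun j hj => hlt j (Finset.mem_union_right _ hj) fun hji => hdisj i hik (hji ▸ hj)) hP hQ h'
  · exact no_dominated_relation hl hb hG i (l - k) (k - l) (Finsupp.mem_support_iff.1 hil)
      (fun j hj => hlt j (Finset.mem_union_right _ hj))
      (fun j hj => hlt j (Finset.mem_union_left _ hj) fun hji => hdisj j hj (hji ▸ hil))
      hQ hP h'.symm

end

/-! ### Application to the three families. -/

/-- The coefficients of the three families. -/
def binomialSumCoeff :
    ({r : ℕ // 3 ≤ r} ⊕ {r : ℕ // 2 ≤ r} ⊕ {r : ℕ // 1 ≤ r}) → ℕ → ℕ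
  | .inl r => binomSum r 0
  | .inr (.inl r) => binomSum r r
  | .inr (.inr r) => binomSum (2 * r) r

/-- The inverse radii of convergence of the three families. -/
noncomputable def binomialSumRate :
    ({r : ℕ // 3 ≤ r} ⊕ {r : ℕ // 2 ≤ r} ⊕ {r : ℕ // 1 ≤ r}) → ℝ
  | .inl r => 2 ^ (r : ℕ)
  | .inr (.inl r) => (3 + 2 * √2) ^ (r : ℕ)
  | .inr (.inr r) => ((11 + 5 * √5) / 2) ^ (r : ℕ)

theorem binomialSumRate_pos (i) : 0 < binomialSumRate i := by
  rcases i with r | r | r <;> simp only [binomialSumRate] <;> positivity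

theorem binomialSumRate_injective : Function.Injective binomialSumRate := by
  have h2 : (1 : ℝ) < 3 + 2 * √2 := by linarith [Real.sqrt_nonneg 2]
  have h5 : (1 : ℝ) < (11 + 5 * √5) / 2 := by linarith [Real.sqrt_nonneg 5]
  rintro (⟨r, hr⟩ | ⟨r, hr⟩ | ⟨r, hr⟩) (⟨s, hs⟩ | ⟨s, hs⟩ | ⟨s, hs⟩) h <;>
    simp only [binomialSumRate] at h
  · simp only [pow_right_injective₀ two_pos (by norm_num : (2 : ℝ) ≠ 1) h]
  · exact absurd h (two_pow_ne_delannoy_rate (by omega))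
  · exact absurd h (two_pow_ne_apery_rate (by omega))
  · exact absurd h.symm (two_pow_ne_delannoy_rate (by omega))
  · simp only [pow_right_injective₀ (by linarith) h2.ne' h]
  · exact absurd h (delannoy_rate_ne_apery_rate (by omega) (by omega))
  · exact absurd h.symm (two_pow_ne_apery_rate (by omega))
  · exact absurd h.symm (delannoy_rate_ne_apery_rate (by omega) (by omega))
  · simp only [pow_right_injective₀ (by linarith) h5.ne' h]

theorem growthBounds_binomialSumCoeff (i) :
    GrowthBounds (binomialSumCoeff i) (binomialSumRate i) := by
  rcases i with r | r | r
  · exact growthBounds_franel r.2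
  · exact growthBounds_delannoy r.2
  · exact growthBounds_apery r.2

theorem binomialSumCoeff_zero (i) : binomialSumCoeff i 0 = 1 := by
  rcases i with r | r | r <;> exact binomSum_zero _ _

theorem binomialSumCoeff_lucas {p : ℕ} (hp : p.Prime) (i) (n : ℕ) {m : ℕ} (hm : m < p) :
    (binomialSumCoeff i (n * p + m) : ZMod p) = binomialSumCoeff i n * binomialSumCoeff i m := by
  rcases i with ⟨r, hr⟩ | ⟨r, hr⟩ | ⟨r, hr⟩ <;>
    exact cast_binomSum_lucas hp (by dsimp only; omega) _ n hm

theorem binomialSumSeries_eq (i) : binomialSumSeries i =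
    PowerSeries.map (Int.castRingHom ℂ) (PowerSeries.mk fun n => (binomialSumCoeff i n : ℤ)) := by
  ext n
  rcases i with r | r | r <;>
    simp [binomialSumSeries, franelSeries, delannoySeries, aperySeries, binomialSumCoeff, binomSum]

/-- The power series are compared over `ℂ(z) = RatFunc ℂ` inside the field `ℂ((z))` of formal
Laurent series, which contains both `ℂ(z)` (each rational function being expanded at `0`) and
`ℂ[[z]]`. Independence of the indexed family includes that its members are pairwise distinct. -/
theorem theorem9p5 :
    AlgebraicIndependent (RatFunc ℂ)
      (fun i => (HahnSeries.ofPowerSeries ℤ ℂ (binomialSumSeries i) : LaurentSeries ℂ)) := by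
  by_contra hdep
  simp only [binomialSumSeries_eq] at hdep
  obtain ⟨k, l, hkl, P, Q, hPQ, h⟩ := exists_proportional_monomials_of_lucas
    (fun i => PowerSeries.mk fun n => (binomialSumCoeff i n : ℤ))
    (fun i => by simp [← PowerSeries.coeff_zero_eq_constantCoeff_apply, binomialSumCoeff_zero])
    (fun p hp i n m hm => by simpa using binomialSumCoeff_lucas hp i n hm) hdep
  have hinj : Function.Injective (algebraMap ℚ ℝ) := (algebraMap ℚ ℝ).injective
  refine no_proportional_monomials binomialSumRate_pos binomialSumRate_injective
    binomialSumCoeff_zero growthBounds_binomialSumCoeff k l hkl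
    (P := P.map (algebraMap ℚ ℝ)) (Q := Q.map (algebraMap ℚ ℝ)) ?_ ?_
  · rwa [Polynomial.map_ne_zero_iff hinj, Polynomial.map_ne_zero_iff hinj]
  · have h1 := congrArg (PowerSeries.map (algebraMap ℚ ℝ)) h
    rw [map_mul, map_mul, map_seriesMonomial, map_seriesMonomial, ← Polynomial.polynomial_map_coe,
      ← Polynomial.polynomial_map_coe] at h1
    have h2 : (fun i => PowerSeries.map (algebraMap ℚ ℝ) (PowerSeries.map (Int.castRingHom ℚ)
        (PowerSeries.mk fun n => (binomialSumCoeff i n : ℤ)))) =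
        fun i => realSeries (binomialSumCoeff i) := by
      funext i
      ext n
      simp [realSeries]
    rwa [h2] at h1
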